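/- **Setting.** One observes $Y_j=X_j\eta_j$, $j=1,\dots,n$, where $X_1,\dots,X_n$ are i.i.d. with unknown density $f_X$, and $\eta_1,\dots,\eta_n$ are i.i.d., independent of the $X_j$, with known density $g$; both densities are supported in $[0,\infty)$. For an estimator $\hat f$ (a measurable function of $Y_1,\dots,Y_n$) of the value $f_X(x_0)$, $x_0>0$, and a class $\Sigma$ of densities, put $$\mathcal R_n[\hat f;\Sigma]=\sup_{f\in\Sigma}\big[\mathbb E_f|\hat f-f(x_0)|^2\big]^{1/2},\qquad \mathcal R_n^*[\Sigma]=\inf_{\hat f}\mathcal R_n[\hat f;\Sigma].$$ For $\beta,A>0$, $r>1$ and $x_0>0$, let $\ell=\max\{k\in\mathbb N_0:k<\beta\}$, and let $\mathscr H_{x_0,r}(A,\beta)$ be the class of all probability densities $f$ supported in $[0,\infty)$ that are $\ell$ times continuously differentiable on $[r^{-1}x_0,rx_0]$ and satisfy there $|f^{(k)}(x)|\le A$ for $k=1,\dots,\ell$ and $|f^{(\ell)}(x)-f^{(\ell)}(x')|\le A|x-x'|^{\beta-\ell}$ for all $x,x'$. Let $\widetilde g(z)=\int_0^\infty x^{z-1}g(x)\,dx$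 be the Mellin transform of $g$, assumed to converge absolutely on an open strip $a<\mathrm{Re}(z)<b$ with $a<1<b$. Consider the following conditions on the line $\mathrm{Re}(z)=1$, with constants $\gamma,\omega_0,c_0>0$, $B_2>B_1>0$ and $B$: * [G1] $|\widetilde g(1+i\omega)|\ge c_0$ for $|\omega|\le\omega_0$, and $B_1|\omega|^{-\gamma}\le|\widetilde g(1+i\omega)|\le B_2|\omega|^{-\gamma}$ for $|\omega|\ge\omega_0$; * [G1$'$] $|\widetilde g'(1+i\omega)|\le B|\omega|^{-\gamma}$ for $|\omega|\ge\omega_0$. **Theorem.** Let $\beta>0$ and $r>1$, and suppose that [G1] and [G1$'$] hold with $\gamma>1/2$. There is a constant $C_4>0$, depending only on $\beta$, $r$ and the constants $\gamma,\omega_0,c_0,B_1,B_2,B$ of [G1] and [G1$'$], such that for every $C_3>0$, every $x_0\ge C_3$ and every $A>0$ $$\liminf_{n\to\infty}\ \phi_n^{-1}\,\mathcal R_n^*[\mathscr H_{x_0,r}(A,\beta)]\ \ge\ C_4,\qquad \phi_n=A^{\frac{2\gamma+1}{2\beta+2\gamma+1}}\Big(\frac{x_0^{2\gamma-1}}{n}\Big)^{\frac{\beta}{2\beta+2\gamma+1}}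 .$$ -/

import Mathlib

open MeasureTheory Filter Set
open scoped ENNReal

/-- `f` is (a version of) a probability density on `ℝ` with support in `[0, ∞)`. -/
structure IsNonnegDensity (f : ℝ → ℝ) : Prop where
  measurable : Measurable f
  nonneg : ∀ x, 0 ≤ f x
  support : ∀ x, x < 0 → f x = 0
  lintegral_eq_one : ∫⁻ x, ENNReal.ofReal (f x) = 1

/-- The measure with Lebesgue density `f`. -/
noncomputable def densityMeasure (f : ℝ → ℝ) : Measure ℝ :=
  volume.withDensity fun x => ENNReal.ofReal (f x)

/-- The largest integer `k ≥ 0` that is strictly smaller than `β` (for `β > 0`). -/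
noncomputable def strictFloor (β : ℝ) : ℕ := ⌈β⌉₊ - 1

lemma isGreatest_strictFloor {β : ℝ} (hβ : 0 < β) :
    IsGreatest {k : ℕ | (k : ℝ) < β} (strictFloor β) := by
  have h0 : 0 < ⌈β⌉₊ := Nat.ceil_pos.mpr hβ
  constructor
  · exact mem_ofPred.mpr (Nat.lt_ceil.mp (by simp only [strictFloor]; omega))
  · intro k hk
    have := Nat.lt_ceil.mpr (mem_ofPred.mp hk)
    simp only [strictFloor]
    omega

/-- The local Hölder class of densities on the interval `[x₀ / r, r x₀]`. -/
structure LocalHolderDensity (x₀ r A β : ℝ) (f : ℝ → ℝ) : Prop where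
  density : IsNonnegDensity f
  contDiffOn : ContDiffOn ℝ (strictFloor β) f (Icc (r⁻¹ * x₀) (r * x₀))
  deriv_le : ∀ k : ℕ, 1 ≤ k → k ≤ strictFloor β → ∀ x ∈ Icc (r⁻¹ * x₀) (r * x₀),
    |iteratedDerivWithin k f (Icc (r⁻¹ * x₀) (r * x₀)) x| ≤ A
  holder : ∀ x ∈ Icc (r⁻¹ * x₀) (r * x₀), ∀ x' ∈ Icc (r⁻¹ * x₀) (r * x₀),
    |iteratedDerivWithin (strictFloor β) f (Icc (r⁻¹ * x₀) (r * x₀)) x -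
      iteratedDerivWithin (strictFloor β) f (Icc (r⁻¹ * x₀) (r * x₀)) x'| ≤
      A * |x - x'| ^ (β - strictFloor β)

/-- The Mellin transform `z ↦ ∫ x in (0, ∞), x ^ (z - 1) * g x` of a real function. -/
noncomputable def mellinTransform (g : ℝ → ℝ) : ℂ → ℂ :=
  mellin fun x => (g x : ℂ)

/-- The Mellin integral of `g` converges absolutely on an open vertical strip that contains
the line `Re z = σ`. -/
def MellinStripAround (g : ℝ → ℝ) (σ : ℝ) : Prop :=
  ∃ a b : ℝ, a < σ ∧ σ < b ∧
    ∀ z : ℂ, a < z.re → z.re < b → MellinConvergent (fun x => (g x : ℂ)) z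

/-- Polynomial decay, of exact order `γ`, of the Mellin transform of `g` on `Re z = σ`, with
explicit constants. -/
structure MellinPolynomialDecay (g : ℝ → ℝ) (σ γ ω₀ c₀ B₁ B₂ : ℝ) : Prop where
  γ_pos : 0 < γ
  ω₀_pos : 0 < ω₀
  c₀_pos : 0 < c₀
  B₁_pos : 0 < B₁
  B₁_lt_B₂ : B₁ < B₂
  center : ∀ ω : ℝ, |ω| ≤ ω₀ → c₀ ≤ ‖mellinTransform g (σ + ω * Complex.I)‖
  lower : ∀ ω : ℝ, ω₀ ≤ |ω| → B₁ * |ω| ^ (-γ) ≤ ‖mellinTransform g (σ + ω * Complex.I)‖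
  upper : ∀ ω : ℝ, ω₀ ≤ |ω| → ‖mellinTransform g (σ + ω * Complex.I)‖ ≤ B₂ * |ω| ^ (-γ)

/-- Polynomial decay of the derivative of the Mellin transform of `g` on `Re z = σ`. -/
def MellinDerivDecay (g : ℝ → ℝ) (σ γ ω₀ B : ℝ) : Prop :=
  ∀ ω : ℝ, ω₀ ≤ |ω| → ‖deriv (mellinTransform g) (σ + ω * Complex.I)‖ ≤ B * |ω| ^ (-γ)

/-- The law of `Y = X η` for independent `X` and `η` with densities `f` and `g`. -/
noncomputable def productLaw (g f : ℝ → ℝ) : Measure ℝ :=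
  ((densityMeasure f).prod (densityMeasure g)).map fun p => p.1 * p.2

/-- The law of the sample `(Y₁, …, Yₙ)` of independent copies of `Y = X η`. -/
noncomputable def sampleLaw (g f : ℝ → ℝ) (n : ℕ) : Measure (Fin n → ℝ) :=
  Measure.pi fun _ => productLaw g f

/-- The root mean squared error of the estimator `T` of `f x₀`. -/
noncomputable def rmse (g : ℝ → ℝ) (x₀ : ℝ) (n : ℕ) (T : (Fin n → ℝ) → ℝ) (f : ℝ → ℝ) : ℝ≥0∞ :=
  (∫⁻ y, ENNReal.ofReal (|T y - f x₀| ^ 2) ∂(sampleLaw g f n)) ^ (1 / 2 : ℝ)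

/-- The maximal risk of `T` over the class `S`. -/
noncomputable def maxRisk (g : ℝ → ℝ) (x₀ : ℝ) (n : ℕ) (S : Set (ℝ → ℝ))
    (T : (Fin n → ℝ) → ℝ) : ℝ≥0∞ :=
  ⨆ f ∈ S, rmse g x₀ n T f

/-- The minimax risk over `S`: the infimum of the maximal risk over all estimators, that is,
over all measurable functions of the sample. -/
noncomputable def minimaxRisk (g : ℝ → ℝ) (x₀ : ℝ) (n : ℕ) (S : Set (ℝ → ℝ)) : ℝ≥0∞ :=
  ⨅ (T : (Fin n → ℝ) → ℝ) (_ : Measurable T), maxRisk g x₀ n S T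

/-- The rate `A ^ ((2γ+1)/(2β+2γ+1)) * (x₀ ^ (2γ-1) / n) ^ (β/(2β+2γ+1))`. -/
noncomputable def minimaxRate (A β γ x₀ : ℝ) (n : ℕ) : ℝ :=
  A ^ ((2 * γ + 1) / (2 * β + 2 * γ + 1)) *
    (x₀ ^ (2 * γ - 1) * (n : ℝ)⁻¹) ^ (β / (2 * β + 2 * γ + 1))

/-! The proof is Le Cam's two-point method in the logarithmic coordinate, where `log Y = log X + log
η` is an additive deconvolution problem and the Mellin transform of `g` on `Re z = 1` is the
characteristic function of `log η` (`charFun_logLaw`).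

The base density of `X` is constant on the Hölder window and has Cauchy tails in `u = log (x / x₀)`.
The alternative adds a bump `a * k (u / h)`. Since the base is flat, only the bump has to satisfy
the smoothness constraints, which allows the height `a` to be of order `A * x₀ ^ (β + 1) * h ^ β`
(`exists_localHolderDensity_of_logBump`).

The Cauchy tails survive convolution with the law of `log η`, so the `χ²` distance between the two
laws of `Y` is at most a constant times the integral of `(1 + w ^ 2) * q w ^ 2`, where `q` is the
smoothed bump (`sqDominated_productLaw_logDensity`). By Plancherel the weight costs one derivative
of the Fourier transform of `q`, which is where the decay of the derivative of the Mellin transform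
enters. The Fourier transform of `k` vanishes at `0` to order above `γ`, so the integral has order
`h ^ (2 * γ + 1)` (`exists_weighted_integral_sq_le`). Choosing `h` so that `n * a ^ 2 * h ^ (2 * γ +
1)` is of order one keeps the two samples of size `n` hard to distinguish, while the values at `x₀`
differ by the order of the rate.

The constant must not depend on `g`. The tail bound needs a compact interval charged uniformly by
all admissible laws of `log η`, which `exists_measureReal_Icc_ge` extracts from the two decay
conditions. All remaining dependence on `g`, `x₀` and `A` goes into how small `h` has to be, and the
limit in `n` absorbs it. -/

/-- The squared `μ`-mean of a nonnegative function is at most `κ` times its second `ν`-moment. -/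
def SqDominated {α : Type*} [MeasurableSpace α] (κ : ℝ≥0∞) (μ ν : Measure α) : Prop :=
  ∀ F : α → ℝ≥0∞, Measurable F → (∫⁻ x, F x ∂μ) ^ 2 ≤ κ * ∫⁻ x, F x ^ 2 ∂ν

lemma ENNReal.sq_lintegral_mul_le {α : Type*} [MeasurableSpace α] (μ : Measure α)
    {f g : α → ℝ≥0∞} (hf : AEMeasurable f μ) (hg : AEMeasurable g μ) :
    (∫⁻ x, f x * g x ∂μ) ^ 2 ≤ (∫⁻ x, f x ^ 2 ∂μ) * ∫⁻ x, g x ^ 2 ∂μ := by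
  have h := ENNReal.lintegral_mul_le_Lp_mul_Lq μ Real.HolderConjugate.two_two hf hg
  calc (∫⁻ x, f x * g x ∂μ) ^ 2
      ≤ ((∫⁻ a, f a ^ (2 : ℝ) ∂μ) ^ (1 / 2 : ℝ) * (∫⁻ a, g a ^ (2 : ℝ) ∂μ) ^ (1 / 2 : ℝ)) ^ 2 := by
        gcongr; exact h
    _ = _ := by
        rw [mul_pow]
        simp only [← ENNReal.rpow_natCast, ← ENNReal.rpow_mul]
        norm_num

/-! ### Second-moment domination and the two-point bound -/

namespace SqDominated

variable {α β : Type*} [MeasurableSpace α] [MeasurableSpace β]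

lemma refl_one (μ : Measure α) [IsProbabilityMeasure μ] : SqDominated 1 μ μ := by
  intro F hF
  have h := ENNReal.sq_lintegral_mul_le μ hF.aemeasurable (aemeasurable_const (b := (1 : ℝ≥0∞)))
  simpa using h

lemma map {κ : ℝ≥0∞} {μ ν : Measure α} (h : SqDominated κ μ ν) {f : α → β} (hf : Measurable f) :
    SqDominated κ (μ.map f) (ν.map f) := by
  intro F hF
  rw [lintegral_map hF hf, lintegral_map (hF.pow_const 2) hf]
  exact h _ (hF.comp hf)

/-- Like `1 + χ²`, the domination constant is multiplicative over independent coordinates: the outer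
domination is applied to the inner integral, then the inner one pointwise. No Radon–Nikodym
derivative is needed. -/
lemma prod {κ κ' : ℝ≥0∞} {μ ν : Measure α} {μ' ν' : Measure β} [SFinite μ] [SFinite ν]
    [SFinite μ'] [SFinite ν'] (h : SqDominated κ μ ν) (h' : SqDominated κ' μ' ν') :
    SqDominated (κ * κ') (μ.prod μ') (ν.prod ν') := by
  intro F hF
  rw [lintegral_prod _ hF.aemeasurable, lintegral_prod _ (hF.pow_const 2).aemeasurable, mul_assoc]
  calc (∫⁻ x, ∫⁻ y, F (x, y) ∂μ' ∂μ) ^ 2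
      ≤ κ * ∫⁻ x, (∫⁻ y, F (x, y) ∂μ') ^ 2 ∂ν := h _ hF.lintegral_prod_right'
    _ ≤ κ * ∫⁻ x, κ' * ∫⁻ y, F (x, y) ^ 2 ∂ν' ∂ν := by
        gcongr with x
        exact h' _ (hF.comp measurable_prodMk_left)
    _ = κ * (κ' * ∫⁻ x, ∫⁻ y, F (x, y) ^ 2 ∂ν' ∂ν) := by
        rw [lintegral_const_mul _ (hF.pow_const 2).lintegral_prod_right']

lemma pi {κ : ℝ≥0∞} {μ ν : Measure α} [IsProbabilityMeasure μ] [IsProbabilityMeasure ν]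
    (h : SqDominated κ μ ν) (n : ℕ) :
    SqDominated (κ ^ n) (Measure.pi fun _ : Fin n => μ) (Measure.pi fun _ : Fin n => ν) := by
  induction n with
  | zero =>
    rw [pow_zero, Measure.pi_of_empty _ Fin.elim0, Measure.pi_of_empty _ Fin.elim0]
    exact refl_one _
  | succ n ih =>
    have hμ := (measurePreserving_piFinSuccAbove (fun _ : Fin (n + 1) => μ) 0).symm
    have hν := (measurePreserving_piFinSuccAbove (fun _ : Fin (n + 1) => ν) 0).symm
    rw [← hμ.map_eq, ← hν.map_eq, pow_succ']
    exact (h.prod ih).map hμ.measurable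

/-- Both errors are measured in `L¹(μ)`, where the triangle inequality applies. Domination moves the
error at `s` from `L²(ν)` to `L¹(μ)` at the price `κ ^ (1 / 2)`. -/
lemma ofReal_abs_sub_le {κ ε : ℝ≥0∞} {μ ν : Measure α} [IsProbabilityMeasure μ]
    (h : SqDominated κ μ ν) {T : α → ℝ} (hT : Measurable T) {s t : ℝ}
    (hs : (∫⁻ y, ENNReal.ofReal (|T y - s| ^ 2) ∂ν) ^ (1 / 2 : ℝ) ≤ ε)
    (ht : (∫⁻ y, ENNReal.ofReal (|T y - t| ^ 2) ∂μ) ^ (1 / 2 : ℝ) ≤ ε) :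
    ENNReal.ofReal |t - s| ≤ (1 + κ ^ (1 / 2 : ℝ)) * ε := by
  have key : ∀ (u : ℝ) (l : ℝ≥0∞) (ρ : Measure α), SqDominated l μ ρ →
      (∫⁻ y, ENNReal.ofReal (|T y - u| ^ 2) ∂ρ) ^ (1 / 2 : ℝ) ≤ ε →
      ∫⁻ y, ENNReal.ofReal |T y - u| ∂μ ≤ l ^ (1 / 2 : ℝ) * ε := by
    intro u l ρ hl hu
    have h1 := hl (fun y => ENNReal.ofReal |T y - u|) (by fun_prop)
    have h2 := ENNReal.rpow_le_rpow h1 (by norm_num : (0 : ℝ) ≤ 1 / 2)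
    rw [ENNReal.mul_rpow_of_nonneg _ _ (by norm_num), ← ENNReal.rpow_natCast,
      ← ENNReal.rpow_mul] at h2
    norm_num at h2
    refine h2.trans ?_
    norm_num at hu ⊢
    gcongr
    refine le_trans (le_of_eq ?_) hu
    congr 2 with y
    rw [← ENNReal.ofReal_pow (abs_nonneg _), sq_abs]
  calc ENNReal.ofReal |t - s| = ∫⁻ _, ENNReal.ofReal |t - s| ∂μ := by simp
    _ ≤ ∫⁻ y, (ENNReal.ofReal |T y - t| + ENNReal.ofReal |T y - s|) ∂μ := by
        gcongr with y
        rw [← ENNReal.ofReal_add (abs_nonneg _) (abs_nonneg _)]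
        apply ENNReal.ofReal_le_ofReal
        have := abs_sub_le t (T y) s
        rwa [abs_sub_comm t (T y)] at this
    _ = ∫⁻ y, ENNReal.ofReal |T y - t| ∂μ + ∫⁻ y, ENNReal.ofReal |T y - s| ∂μ :=
        lintegral_add_left (by fun_prop) _
    _ ≤ (1 : ℝ≥0∞) ^ (1 / 2 : ℝ) * ε + κ ^ (1 / 2 : ℝ) * ε :=
        add_le_add (key t 1 μ (refl_one μ) ht) (key s κ ν h hs)
    _ = _ := by rw [ENNReal.one_rpow, add_mul]

end SqDominated

lemma IsNonnegDensity.isProbabilityMeasure {f : ℝ → ℝ} (hf : IsNonnegDensity f) :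
    IsProbabilityMeasure (densityMeasure f) :=
  ⟨by rw [densityMeasure, withDensity_apply _ MeasurableSet.univ, setLIntegral_univ,
    hf.lintegral_eq_one]⟩

lemma isProbabilityMeasure_productLaw {g f : ℝ → ℝ} (hg : IsNonnegDensity g)
    (hf : IsNonnegDensity f) : IsProbabilityMeasure (productLaw g f) := by
  have := hg.isProbabilityMeasure
  have := hf.isProbabilityMeasure
  exact Measure.isProbabilityMeasure_map (by fun_prop)

/-- **Two-point lower bound** for the minimax risk. -/
lemma ofReal_abs_sub_le_minimaxRisk {g f₀ f₁ : ℝ → ℝ} (hg : IsNonnegDensity g)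
    (h₀ : IsNonnegDensity f₀) (h₁ : IsNonnegDensity f₁) {S : Set (ℝ → ℝ)} (hS₀ : f₀ ∈ S)
    (hS₁ : f₁ ∈ S) {n : ℕ} (hn : n ≠ 0)
    (h : SqDominated (1 + (n : ℝ≥0∞)⁻¹) (productLaw g f₁) (productLaw g f₀)) (x₀ : ℝ) :
    ENNReal.ofReal |f₁ x₀ - f₀ x₀| ≤ 3 * minimaxRisk g x₀ n S := by
  have := isProbabilityMeasure_productLaw hg h₀
  have := isProbabilityMeasure_productLaw hg h₁
  -- A per-observation excess of `1 / n` tensorizes to at most `e ≤ 4`. This gives the factor `3 = 1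
  -- + 2` uniformly in `n`.
  have hκ : ((1 + (n : ℝ≥0∞)⁻¹) ^ n) ^ (1 / 2 : ℝ) ≤ 2 := by
    have h1 : (1 + (n : ℝ≥0∞)⁻¹) = ENNReal.ofReal (1 + (n : ℝ)⁻¹) := by
      rw [ENNReal.ofReal_add (by norm_num) (by positivity), ENNReal.ofReal_one,
        ENNReal.ofReal_inv_of_pos (by positivity), ENNReal.ofReal_natCast]
    have h2 : (1 + (n : ℝ)⁻¹) ^ n ≤ 4 := by
      have h3 : (1 + (n : ℝ)⁻¹) ≤ Real.exp ((n : ℝ)⁻¹) := by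
        linarith [Real.add_one_le_exp ((n : ℝ)⁻¹)]
      calc (1 + (n : ℝ)⁻¹) ^ n ≤ (Real.exp ((n : ℝ)⁻¹)) ^ n := by gcongr
        _ = Real.exp 1 := by
          rw [← Real.exp_nat_mul, mul_inv_cancel₀ (by positivity)]
        _ ≤ 4 := by linarith [Real.exp_one_lt_d9]
    rw [h1, ← ENNReal.ofReal_pow (by positivity)]
    calc (ENNReal.ofReal ((1 + (n : ℝ)⁻¹) ^ n)) ^ (1 / 2 : ℝ)
        ≤ (ENNReal.ofReal (2 ^ (2 : ℕ))) ^ (1 / 2 : ℝ) := by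
          gcongr
          linarith
      _ = 2 := by
          rw [ENNReal.ofReal_pow (by norm_num), ← ENNReal.rpow_natCast, ← ENNReal.rpow_mul]
          norm_num
  simp only [minimaxRisk, ENNReal.mul_iInf_of_ne (by norm_num : (3 : ℝ≥0∞) ≠ 0) (by norm_num)]
  refine le_iInf₂ fun T hT => ?_
  refine ((h.pi n).ofReal_abs_sub_le hT (ε := maxRisk g x₀ n S T) ?_ ?_).trans ?_
  · exact le_iSup₂_of_le (f := fun f (_ : f ∈ S) => rmse g x₀ n T f) f₀ hS₀ le_rfl
  · exact le_iSup₂_of_le (f := fun f (_ : f ∈ S) => rmse g x₀ n T f) f₁ hS₁ le_rfl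
  · gcongr
    calc _ ≤ (1 : ℝ≥0∞) + 2 := by gcongr
      _ = 3 := by norm_num

/-! ### Hölder regularity of bumps in the logarithmic coordinate -/

section LogBump

open scoped ContDiff

/-- The bump `k`, rescaled by `h` in the logarithmic coordinate around `x₀`. -/
noncomputable def logBump (k : ℝ → ℝ) (m : ℕ) (x₀ h x : ℝ) : ℝ :=
  ((x / x₀) ^ m)⁻¹ * k (Real.log (x / x₀) / h)

lemma contDiffOn_logBump {k : ℝ → ℝ} (hk : ContDiff ℝ ∞ k) (m : ℕ) {x₀ : ℝ} (hx₀ : 0 < x₀) (h : ℝ)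
    {s : Set ℝ} (hs : s ⊆ Ioi 0) : ContDiffOn ℝ ∞ (logBump k m x₀ h) s := by
  have hq : ∀ x ∈ s, x / x₀ ≠ 0 := fun x hx => (div_pos (hs hx) hx₀).ne'
  have hd : ContDiffOn ℝ ∞ (fun x : ℝ => x / x₀) s := by fun_prop
  have hl : ContDiffOn ℝ ∞ (fun x : ℝ => Real.log (x / x₀) / h) s := (hd.log hq).div_const h
  exact ((hd.pow m).inv fun x hx => pow_ne_zero _ (hq x hx)).mul (hk.comp_contDiffOn hl)

/-- The power `m` in `logBump` is there so that the family is closed under differentiation: the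
derivative is a combination of two members with exponent `m + 1`. -/
lemma hasDerivAt_logBump {k : ℝ → ℝ} (hk : ContDiff ℝ ∞ k) (m : ℕ) {x₀ h x : ℝ} (hx₀ : 0 < x₀)
    (hh : 0 < h) (hx : 0 < x) :
    HasDerivAt (logBump k m x₀ h)
      ((x₀ * h)⁻¹ * logBump (deriv k) (m + 1) x₀ h x + -(x₀⁻¹ * m) * logBump k (m + 1) x₀ h x) x := by
  have hq : x / x₀ ≠ 0 := (div_pos hx hx₀).ne'
  have hd : HasDerivAt (fun x : ℝ => x / x₀) (1 / x₀) x := (hasDerivAt_id x).div_const x₀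
  have h1 := (hd.pow m).inv (pow_ne_zero m hq)
  have h2 := ((hk.differentiable (by simp)).differentiableAt.hasDerivAt).comp x
    ((hd.log hq).div_const h)
  refine (h1.mul h2).congr_deriv ?_
  simp only [logBump, Function.comp_apply, Pi.pow_apply, Pi.inv_apply]
  have := hx₀.ne'
  have := hh.ne'
  generalize x / x₀ = y at hq ⊢
  rcases m with _ | m
  · simp; field_simp
  · simp only [Nat.add_sub_cancel]
    field_simp
    ring

lemma Icc_inv_mul_subset_Ioi {r x₀ : ℝ} (hr : 1 < r) (hx₀ : 0 < x₀) :
    Icc (r⁻¹ * x₀) (r * x₀) ⊆ Ioi 0 := fun _ hx =>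
  lt_of_lt_of_le (by positivity) hx.1

lemma inv_mul_lt_mul {r x₀ : ℝ} (hr : 1 < r) (hx₀ : 0 < x₀) : r⁻¹ * x₀ < r * x₀ := by
  gcongr
  exact (inv_lt_one_of_one_lt₀ hr).trans hr

/-- Each differentiation costs `(x₀ * h)⁻¹` when it hits the profile and only `x₀⁻¹` when it hits
the power, which is no worse since `h ≤ 1`. On the window `x / x₀` stays above `r⁻¹`, so the
constants depend on neither `x₀` nor `h`. -/
lemma exists_abs_iteratedDerivWithin_logBump_le {r : ℝ} (hr : 1 < r) (j : ℕ) :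
    ∀ (m : ℕ) (k : ℝ → ℝ), ContDiff ℝ ∞ k → HasCompactSupport k →
      ∃ C : ℝ, 0 ≤ C ∧ ∀ x₀ h : ℝ, 0 < x₀ → 0 < h → h ≤ 1 →
        ∀ x ∈ Icc (r⁻¹ * x₀) (r * x₀),
          |iteratedDerivWithin j (logBump k m x₀ h) (Icc (r⁻¹ * x₀) (r * x₀)) x| ≤
            C * ((x₀ * h) ^ j)⁻¹ := by
  induction j with
  | zero =>
    intro m k hk hs
    obtain ⟨C, hC⟩ := hk.continuous.bounded_above_of_compact_support hs
    have hC0 : 0 ≤ C := (norm_nonneg _).trans (hC 0)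
    refine ⟨r ^ m * C, by positivity, fun x₀ h hx₀ hh _ x hx => ?_⟩
    simp only [iteratedDerivWithin_zero, logBump, pow_zero, inv_one, mul_one, abs_mul]
    have h1 : r⁻¹ ≤ x / x₀ := (le_div_iff₀ hx₀).2 hx.1
    have hr0 : 0 < r⁻¹ := by positivity
    gcongr
    · rw [abs_of_nonneg (by have := hr0.trans_le h1; positivity), ← inv_pow]
      gcongr
      · exact (inv_pos.2 (hr0.trans_le h1)).le
      · exact inv_le_of_inv_le₀ (by positivity) h1
    · exact hC _
  | succ j ih =>
    intro m k hk hs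
    obtain ⟨C₁, hC₁, H₁⟩ := ih (m + 1) (deriv k) (contDiff_infty_iff_deriv.1 hk).2 hs.deriv
    obtain ⟨C₂, hC₂, H₂⟩ := ih (m + 1) k hk hs
    refine ⟨C₁ + m * C₂, by positivity, fun x₀ h hx₀ hh hh1 x hx => ?_⟩
    have hu : UniqueDiffOn ℝ (Icc (r⁻¹ * x₀) (r * x₀)) := uniqueDiffOn_Icc (inv_mul_lt_mul hr hx₀)
    have hsub := Icc_inv_mul_subset_Ioi hr hx₀
    have hE : EqOn (derivWithin (logBump k m x₀ h) (Icc (r⁻¹ * x₀) (r * x₀)))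
        (fun x => (x₀ * h)⁻¹ * logBump (deriv k) (m + 1) x₀ h x +
          -(x₀⁻¹ * m) * logBump k (m + 1) x₀ h x) (Icc (r⁻¹ * x₀) (r * x₀)) := fun y hy =>
      (hasDerivAt_logBump hk m hx₀ hh (hsub hy)).hasDerivWithinAt.derivWithin (hu y hy)
    have hc₁ : ContDiffWithinAt ℝ j (logBump (deriv k) (m + 1) x₀ h)
        (Icc (r⁻¹ * x₀) (r * x₀)) x :=
      (contDiffOn_logBump (contDiff_infty_iff_deriv.1 hk).2 (m + 1) hx₀ h hsub x hx).of_le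
        (mod_cast le_top)
    have hc₂ : ContDiffWithinAt ℝ j (logBump k (m + 1) x₀ h) (Icc (r⁻¹ * x₀) (r * x₀)) x :=
      (contDiffOn_logBump hk (m + 1) hx₀ h hsub x hx).of_le (mod_cast le_top)
    rw [iteratedDerivWithin_succ', iteratedDerivWithin_congr hE hx,
      iteratedDerivWithin_fun_add hx hu (contDiffWithinAt_const.mul hc₁)
        (contDiffWithinAt_const.mul hc₂), iteratedDerivWithin_const_mul_field,
      iteratedDerivWithin_const_mul_field]
    refine (abs_add_le _ _).trans ?_
    rw [abs_mul, abs_mul, abs_neg, abs_of_pos (by positivity : 0 < (x₀ * h)⁻¹),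
      abs_of_nonneg (by positivity : 0 ≤ x₀⁻¹ * (m : ℝ))]
    have e₁ := H₁ x₀ h hx₀ hh hh1 x hx
    have e₂ := H₂ x₀ h hx₀ hh hh1 x hx
    have e₃ : x₀⁻¹ ≤ (x₀ * h)⁻¹ := by
      gcongr
      exact mul_le_of_le_one_right hx₀.le hh1
    calc _ ≤ (x₀ * h)⁻¹ * (C₁ * ((x₀ * h) ^ j)⁻¹) + (x₀ * h)⁻¹ * m * (C₂ * ((x₀ * h) ^ j)⁻¹) := by
          gcongr
      _ = _ := by rw [pow_succ, mul_inv]; ring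

lemma strictFloor_lt {β : ℝ} (hβ : 0 < β) : (strictFloor β : ℝ) < β :=
  (isGreatest_strictFloor hβ).1

lemma le_strictFloor_add_one {β : ℝ} (hβ : 0 < β) : β ≤ strictFloor β + 1 := by
  by_contra! hlt
  have := (isGreatest_strictFloor hβ).2
    (show strictFloor β + 1 ∈ {k : ℕ | (k : ℝ) < β} from mem_ofPred.mpr (by push_cast; exact hlt))
  omega

/-- A constant plus a logarithmic bump of small height is in the local Hölder class. -/
lemma exists_localHolderDensity_of_logBump {β r : ℝ} (hβ : 0 < β) (hr : 1 < r) {k : ℝ → ℝ}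
    (hk : ContDiff ℝ ∞ k) (hs : HasCompactSupport k) :
    ∃ C : ℝ, 0 < C ∧ ∀ (x₀ h A b e : ℝ) (f : ℝ → ℝ), 0 < x₀ → 0 < h → h ≤ 1 → x₀ * h ≤ 1 →
      0 ≤ b → b * C ≤ A * (x₀ * h) ^ β → IsNonnegDensity f →
      (∀ x ∈ Icc (r⁻¹ * x₀) (r * x₀), f x = e + b * logBump k 1 x₀ h x) →
      LocalHolderDensity x₀ r A β f := by
  choose C hC0 hC using fun j => exists_abs_iteratedDerivWithin_logBump_le hr j 1 k hk hs
  set ℓ := strictFloor β with hℓ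
  have hℓβ := strictFloor_lt hβ
  have hβℓ := le_strictFloor_add_one hβ
  rw [← hℓ] at hℓβ hβℓ
  -- One constant serves all orders up to `ℓ + 1`. The last order is needed for the mean value
  -- estimate on the derivative of order `ℓ`.
  have hle : ∀ j ≤ ℓ + 1, C j ≤ ∑ i ∈ Finset.range (ℓ + 2), C i := fun j hj =>
    Finset.single_le_sum (fun i _ => hC0 i) (Finset.mem_range.2 (by omega))
  set D := ∑ i ∈ Finset.range (ℓ + 2), C i with hD
  have hD0 : 0 ≤ D := (hC0 0).trans (hle 0 (by omega))
  refine ⟨2 * D + 1, by positivity, fun x₀ h A b e f hx₀ hh hh1 hxh hb hbC hf hfe => ?_⟩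
  set S := Icc (r⁻¹ * x₀) (r * x₀) with hS
  have hu : UniqueDiffOn ℝ S := uniqueDiffOn_Icc (inv_mul_lt_mul hr hx₀)
  have hsub : S ⊆ Ioi 0 := Icc_inv_mul_subset_Ioi hr hx₀
  have hy : 0 < x₀ * h := by positivity
  have hsm := contDiffOn_logBump hk 1 hx₀ h hsub
  have hG : ∀ j ≤ ℓ + 1, ∀ x ∈ S, |iteratedDerivWithin j (logBump k 1 x₀ h) S x| ≤
      D * (x₀ * h) ^ (-(j : ℝ)) := fun j hj x hx => by
    rw [Real.rpow_neg hy.le, Real.rpow_natCast]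
    refine (hC j x₀ h hx₀ hh hh1 x hx).trans ?_
    gcongr
    exact hle j hj
  have hiter : ∀ j, 1 ≤ j → ∀ x ∈ S, iteratedDerivWithin j f S x =
      b * iteratedDerivWithin j (logBump k 1 x₀ h) S x := fun j hj x hx => by
    rw [iteratedDerivWithin_congr (g := fun x => e + b * logBump k 1 x₀ h x) hfe hx,
      iteratedDerivWithin_const_add (by omega), iteratedDerivWithin_const_mul_field]
  have hbD : 2 * (b * D) ≤ A * (x₀ * h) ^ β := by nlinarith
  have hA : 0 ≤ A := by
    by_contra! hA
    have := Real.rpow_pos_of_pos hy β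
    nlinarith [mul_nonneg hb hD0]
  refine ⟨hf, ?_, fun j hj1 hjl x hx => ?_, fun x hx x' hx' => ?_⟩
  · refine ContDiffOn.congr ?_ hfe
    exact contDiffOn_const.add (contDiffOn_const.mul (hsm.of_le (mod_cast le_top)))
  · rw [hiter j hj1 x hx, abs_mul, abs_of_nonneg hb]
    have hjβ : (j : ℝ) ≤ β := le_trans (by exact_mod_cast hjl) hℓβ.le
    calc b * |iteratedDerivWithin j (logBump k 1 x₀ h) S x|
        ≤ b * (D * (x₀ * h) ^ (-(j : ℝ))) := by
          gcongr
          exact hG j (by omega) x hx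
      _ = (b * D) * (x₀ * h) ^ (-(j : ℝ)) := by ring
      _ ≤ (A * (x₀ * h) ^ β) * (x₀ * h) ^ (-(j : ℝ)) := by
          exact mul_le_mul_of_nonneg_right (by linarith [mul_nonneg hb hD0]) (by positivity)
      _ = A * (x₀ * h) ^ (β - j) := by rw [mul_assoc, ← Real.rpow_add hy, sub_eq_add_neg]
      _ ≤ A * 1 := by
          gcongr
          exact Real.rpow_le_one hy.le hxh (by linarith)
      _ = A := mul_one A
  · have hdiff : iteratedDerivWithin ℓ f S x - iteratedDerivWithin ℓ f S x' =
        b * (iteratedDerivWithin ℓ (logBump k 1 x₀ h) S x -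
          iteratedDerivWithin ℓ (logBump k 1 x₀ h) S x') := by
      -- For `ℓ = 0` the additive constant `e` is not killed by differentiation; it cancels in the
      -- difference instead.
      rcases Nat.eq_zero_or_pos ℓ with h0 | h0
      · rw [h0]
        simp only [iteratedDerivWithin_zero, hfe x hx, hfe x' hx']
        ring
      · rw [hiter ℓ h0 x hx, hiter ℓ h0 x' hx']; ring
    set s := β - ℓ with hs
    have hs0 : 0 < s := by rw [hs]; linarith
    have hs1 : s ≤ 1 := by rw [hs]; linarith
    set Δ := |iteratedDerivWithin ℓ (logBump k 1 x₀ h) S x -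
          iteratedDerivWithin ℓ (logBump k 1 x₀ h) S x'| with hΔ
    have h1 : Δ ≤ 2 * D * (x₀ * h) ^ (-(ℓ : ℝ)) := by
      refine (abs_sub _ _).trans ?_
      linarith [hG ℓ (by omega) x hx, hG ℓ (by omega) x' hx']
    have h2 : Δ ≤ D * (x₀ * h) ^ (-((ℓ + 1 : ℕ) : ℝ)) * |x - x'| := by
      have := (convex_Icc (r⁻¹ * x₀) (r * x₀)).norm_image_sub_le_of_norm_derivWithin_le
        (f := iteratedDerivWithin ℓ (logBump k 1 x₀ h) S)
        (C := D * (x₀ * h) ^ (-((ℓ + 1 : ℕ) : ℝ)))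
        (hsm.differentiableOn_iteratedDerivWithin (mod_cast (WithTop.coe_lt_top _)) hu)
        (fun y hy' => by
          rw [← iteratedDerivWithin_succ]
          exact hG (ℓ + 1) le_rfl y hy') hx' hx
      exact this
    -- Interpolation between the trivial bound and the mean value bound, through `min 1 t ≤ t ^ s`
    -- for `0 < s ≤ 1`.
    have h3 : Δ ≤ 2 * D * (x₀ * h) ^ (-(ℓ : ℝ)) * (|x - x'| / (x₀ * h)) ^ s := by
      rcases le_total 1 (|x - x'| / (x₀ * h)) with ht | ht
      · exact h1.trans (le_mul_of_one_le_right (by positivity) (Real.one_le_rpow ht hs0.le))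
      · have h4 : |x - x'| / (x₀ * h) ≤ (|x - x'| / (x₀ * h)) ^ s := by
          simpa using Real.rpow_le_rpow_of_exponent_ge' (by positivity) ht hs0.le hs1
        calc Δ ≤ D * (x₀ * h) ^ (-(ℓ : ℝ)) * (|x - x'| / (x₀ * h)) := by
              refine h2.trans (le_of_eq ?_)
              push_cast
              rw [neg_add, Real.rpow_add hy, Real.rpow_neg_one]
              ring
          _ ≤ 2 * D * (x₀ * h) ^ (-(ℓ : ℝ)) * (|x - x'| / (x₀ * h)) ^ s := by
              gcongr
              linarith
    rw [hdiff, abs_mul, abs_of_nonneg hb]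
    calc b * Δ ≤ b * (2 * D * (x₀ * h) ^ (-(ℓ : ℝ)) * (|x - x'| / (x₀ * h)) ^ s) := by gcongr
      _ = 2 * (b * D) * (x₀ * h) ^ (-β) * |x - x'| ^ s := by
          rw [Real.div_rpow (abs_nonneg _) hy.le, div_eq_mul_inv, ← Real.rpow_neg hy.le,
            show -β = -(ℓ : ℝ) + -s by rw [hs]; ring, Real.rpow_add hy]
          ring
      _ ≤ A * (x₀ * h) ^ β * (x₀ * h) ^ (-β) * |x - x'| ^ s := by gcongr
      _ = A * |x - x'| ^ s := by
          rw [mul_assoc A, ← Real.rpow_add hy, add_neg_cancel, Real.rpow_zero, mul_one]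

end LogBump

/-! ### Fourier analysis of the bump and of its smoothing -/

section Fourier

open scoped ContDiff FourierTransform Real

lemma iteratedDeriv_ofReal_comp {f : ℝ → ℝ} (hf : ContDiff ℝ ∞ f) (n : ℕ) :
    iteratedDeriv n (fun x => (f x : ℂ)) = fun x => ((iteratedDeriv n f x : ℝ) : ℂ) := by
  induction n with
  | zero => simp
  | succ n ih =>
    ext x
    rw [iteratedDeriv_succ, ih, iteratedDeriv_succ]
    exact ((hf.differentiable_iteratedDeriv n (mod_cast WithTop.coe_lt_top _)) x).hasDerivAt.ofReal_comp.deriv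

/-- Near the origin the zero of order `n ≥ s` gives the factor `|ξ| ^ s`; away from it Schwartz
decay gives `(1 + ξ ^ 2)⁻¹` and `|ξ| ^ s ≥ 1`. -/
lemma SchwartzMap.exists_pow_mul_norm_le_rpow (Φ : SchwartzMap ℝ ℂ) {n : ℕ} {s : ℝ} (hs : 0 ≤ s)
    (hn : s ≤ n) :
    ∃ C : ℝ, 0 ≤ C ∧ ∀ ξ : ℝ, |ξ| ^ n * ‖Φ ξ‖ ≤ C * (|ξ| ^ s * (1 + ξ ^ 2)⁻¹) := by
  obtain ⟨C₀, hC₀, h₀⟩ := Φ.decay 0 0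
  obtain ⟨C₁, hC₁, h₁⟩ := Φ.decay n 0
  obtain ⟨C₂, hC₂, h₂⟩ := Φ.decay (n + 2) 0
  simp only [norm_iteratedFDeriv_zero, Real.norm_eq_abs] at h₀ h₁ h₂
  refine ⟨2 * C₀ + C₁ + C₂, by positivity, fun ξ => ?_⟩
  rw [← mul_assoc, ← div_eq_mul_inv, le_div_iff₀ (by positivity)]
  have hΦ := norm_nonneg (Φ ξ)
  rcases le_total |ξ| 1 with h | h
  · have h3 : |ξ| ^ n ≤ |ξ| ^ s := by
      rw [← Real.rpow_natCast]
      exact Real.rpow_le_rpow_of_exponent_ge' (abs_nonneg _) h hs hn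
    have h4 : 1 + ξ ^ 2 ≤ 2 := by nlinarith [abs_nonneg ξ, sq_abs ξ]
    have h5 : ‖Φ ξ‖ ≤ C₀ := by simpa using h₀ ξ
    calc |ξ| ^ n * ‖Φ ξ‖ * (1 + ξ ^ 2) ≤ |ξ| ^ s * C₀ * 2 := by gcongr
      _ = (2 * C₀) * |ξ| ^ s := by ring
      _ ≤ _ := by gcongr; linarith
  · have h3 : 1 ≤ |ξ| ^ s := Real.one_le_rpow h hs
    calc |ξ| ^ n * ‖Φ ξ‖ * (1 + ξ ^ 2) = |ξ| ^ n * ‖Φ ξ‖ + |ξ| ^ (n + 2) * ‖Φ ξ‖ := by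
          rw [← sq_abs ξ]; ring
      _ ≤ C₁ + C₂ := add_le_add (h₁ ξ) (h₂ ξ)
      _ ≤ 2 * C₀ + C₁ + C₂ := by linarith
      _ ≤ _ := le_mul_of_one_le_right (by positivity) h3

/-- A smooth bump supported in `[-1, 1]` whose Fourier transform vanishes at `0` to a prescribed
order. -/
lemma exists_bump_fourier_bound {γ : ℝ} (hγ : 0 < γ) :
    ∃ k : ℝ → ℝ, ContDiff ℝ ∞ k ∧ HasCompactSupport k ∧ (∀ u, 1 < |u| → k u = 0) ∧ k 0 = 1 ∧
      ∃ C : ℝ, 0 ≤ C ∧ ∀ ξ : ℝ,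
        ‖𝓕 (fun u => (k u : ℂ)) ξ‖ ≤ C * (|ξ| ^ γ * (1 + ξ ^ 2)⁻¹) ∧
        ‖𝓕 (fun u => (k u : ℂ)) ξ‖ ≤ C * (|ξ| ^ (γ + 1) * (1 + ξ ^ 2)⁻¹) ∧
        ‖deriv (𝓕 (fun u => (k u : ℂ))) ξ‖ ≤ C * (|ξ| ^ γ * (1 + ξ ^ 2)⁻¹) := by
  set M := ⌈γ⌉₊ with hM
  have hMγ : γ ≤ M := Nat.le_ceil γ
  set χ : ContDiffBump (0 : ℝ) := ⟨1 / 2, 1, by norm_num, by norm_num⟩ with hχ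
  -- The bump is the derivative of order `M + 1` of `K`. Differentiation puts the factor `ξ ^ (M +
  -- 1)`, with `M + 1 ≥ γ + 1`, on the transform. Since `χ = 1` near `0`, `K` is there the monomial
  -- whose derivative of that order is `1`.
  set K : ℝ → ℝ := fun u => ((M + 1).factorial : ℝ)⁻¹ * (u ^ (M + 1) * χ u) with hK
  have hKs : ContDiff ℝ ∞ K := contDiff_const.mul ((contDiff_id.pow _).mul χ.contDiff)
  have hKc : HasCompactSupport K := (χ.hasCompactSupport.mul_left).mul_left
  have hKC : HasCompactSupport fun u => (K u : ℂ) := hKc.comp_left Complex.ofReal_zero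
  have hKCs : ContDiff ℝ ∞ fun u => (K u : ℂ) := Complex.ofRealCLM.contDiff.comp hKs
  set S : SchwartzMap ℝ ℂ := hKC.toSchwartzMap hKCs with hS
  have hSK : (S : ℝ → ℂ) = fun u => (K u : ℂ) := rfl
  set Φ : SchwartzMap ℝ ℂ := 𝓕 S with hΦ
  have hΦK : (Φ : ℝ → ℂ) = 𝓕 (fun u => (K u : ℂ)) := by rw [hΦ, SchwartzMap.fourier_coe, hSK]
  set k := iteratedDeriv (M + 1) K with hk
  have hks : ContDiff ℝ ∞ k := by
    rw [hk, iteratedDeriv_eq_iterate]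
    exact hKs.iterate_deriv (M + 1)
  have hksupp : ∀ n, tsupport (iteratedDeriv n K) ⊆ tsupport K := by
    intro n
    induction n with
    | zero => simp
    | succ n ih => rw [iteratedDeriv_succ]; exact (tsupport_deriv_subset).trans ih
  have hKt : tsupport K ⊆ Metric.closedBall 0 1 := by
    have h1 : tsupport K ⊆ tsupport χ := by
      refine closure_mono fun u hu => ?_
      simp only [hK, Function.mem_support] at hu ⊢
      exact right_ne_zero_of_mul (right_ne_zero_of_mul hu)
    exact h1.trans (by rw [χ.tsupport_eq])
  have hkc : HasCompactSupport k := hKc.of_isClosed_subset (isClosed_tsupport _) (hksupp _)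
  have hfk : 𝓕 (fun u => (k u : ℂ)) = fun ξ => (2 * π * Complex.I * ξ) ^ (M + 1) * Φ ξ := by
    have h1 := Real.fourier_iteratedDeriv (f := fun u => (K u : ℂ)) (N := ⊤) (n := M + 1) hKCs
      (fun n _ => by
        rw [iteratedDeriv_ofReal_comp hKs]
        have hcs : HasCompactSupport (iteratedDeriv n K) :=
          hKc.of_isClosed_subset (isClosed_tsupport _) (hksupp _)
        exact (((hKs.continuous_iteratedDeriv n (mod_cast le_top)).integrable_of_hasCompactSupport
          hcs)).ofReal) le_top
    rw [iteratedDeriv_ofReal_comp hKs] at h1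
    rw [h1, hΦK]
    rfl
  have hdk : ∀ ξ : ℝ, deriv (𝓕 (fun u => (k u : ℂ))) ξ =
      (2 * π * Complex.I) ^ (M + 1) * ((M + 1) * (ξ ^ M * Φ ξ) + ξ ^ (M + 1) * deriv Φ ξ) := by
    intro ξ
    have h1 : HasDerivAt (fun ξ : ℝ => (2 * π * Complex.I * ξ) ^ (M + 1))
        ((M + 1 : ℕ) * (2 * π * Complex.I * ξ) ^ M * (2 * π * Complex.I * 1)) ξ := by
      have := ((hasDerivAt_id ξ).ofReal_comp.const_mul (2 * π * Complex.I)).pow (M + 1)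
      exact this.congr_deriv (by simp)
    rw [hfk, (h1.fun_mul Φ.differentiableAt.hasDerivAt).deriv]
    push_cast
    ring
  obtain ⟨C₁, hC₁, H₁⟩ := Φ.exists_pow_mul_norm_le_rpow (n := M + 1) hγ.le (by push_cast; linarith)
  obtain ⟨C₂, hC₂, H₂⟩ := Φ.exists_pow_mul_norm_le_rpow (n := M + 1) (s := γ + 1) (by positivity)
    (by push_cast; linarith)
  obtain ⟨C₃, hC₃, H₃⟩ := Φ.exists_pow_mul_norm_le_rpow (n := M) hγ.le hMγ
  obtain ⟨C₄, hC₄, H₄⟩ := (SchwartzMap.derivCLM ℝ ℂ Φ).exists_pow_mul_norm_le_rpow (n := M + 1)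
    hγ.le (by push_cast; linarith)
  set P : ℝ := (2 * π) ^ (M + 1) with hP
  have hP0 : 0 ≤ P := by positivity
  have hnP : ‖(2 * π * Complex.I : ℂ) ^ (M + 1)‖ = P := by
    simp [hP, abs_of_pos Real.pi_pos]
  have hnf : ∀ ξ, ‖𝓕 (fun u => (k u : ℂ)) ξ‖ = P * (|ξ| ^ (M + 1) * ‖Φ ξ‖) := fun ξ => by
    rw [hfk]
    simp only
    rw [mul_pow, mul_assoc, norm_mul, hnP]
    simp
  refine ⟨k, hks, hkc, fun u hu => ?_, ?_, P * (C₁ + C₂ + ((M + 1) * C₃ + C₄)), by positivity,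
    fun ξ => ⟨?_, ?_, ?_⟩⟩
  · refine image_eq_zero_of_notMem_tsupport fun hmem => ?_
    have := hKt (hksupp _ hmem)
    rw [mem_closedBall_zero_iff, Real.norm_eq_abs] at this
    linarith
  · have h1 : K =ᶠ[nhds 0] fun u => ((M + 1).factorial : ℝ)⁻¹ * u ^ (M + 1) := by
      filter_upwards [χ.eventuallyEq_one] with u hu
      simp [hK, hu]
    rw [hk, h1.iteratedDeriv_eq, iteratedDeriv_const_mul_field]
    simp only [iteratedDeriv_pow, Nat.descFactorial_self, Nat.sub_self, pow_zero, mul_one]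
    exact inv_mul_cancel₀ (by positivity)
  · rw [hnf]
    calc _ ≤ P * (C₁ * (|ξ| ^ γ * (1 + ξ ^ 2)⁻¹)) := 
          mul_le_mul_of_nonneg_left (H₁ ξ) hP0
      _ ≤ _ := by
        rw [← mul_assoc]; gcongr
        linarith [show 0 ≤ (M + 1) * C₃ + C₄ by positivity]
  · rw [hnf]
    calc _ ≤ P * (C₂ * (|ξ| ^ (γ + 1) * (1 + ξ ^ 2)⁻¹)) := 
          mul_le_mul_of_nonneg_left (H₂ ξ) hP0
      _ ≤ _ := by
        rw [← mul_assoc]; gcongr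
        linarith [show 0 ≤ (M + 1) * C₃ + C₄ by positivity]
  · rw [hdk, norm_mul, hnP]
    have h4 := H₄ ξ
    rw [SchwartzMap.derivCLM_apply] at h4
    calc _ ≤ P * ((M + 1) * (|ξ| ^ M * ‖Φ ξ‖) + |ξ| ^ (M + 1) * ‖deriv Φ ξ‖) := by
          gcongr
          refine (norm_add_le _ _).trans (le_of_eq ?_)
          simp only [norm_mul, norm_pow, Complex.norm_real, Real.norm_eq_abs]
          congr 2
          exact_mod_cast Complex.norm_natCast (M + 1)
      _ ≤ P * ((M + 1) * (C₃ * (|ξ| ^ γ * (1 + ξ ^ 2)⁻¹)) + C₄ * (|ξ| ^ γ * (1 + ξ ^ 2)⁻¹)) := 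
          mul_le_mul_of_nonneg_left (add_le_add
            (mul_le_mul_of_nonneg_left (H₃ ξ) (by positivity)) h4) hP0
      _ = P * ((M + 1) * C₃ + C₄) * (|ξ| ^ γ * (1 + ξ ^ 2)⁻¹) := by ring
      _ ≤ _ := mul_le_mul_of_nonneg_right
          (mul_le_mul_of_nonneg_left (by linarith) hP0) (by positivity)

/-- **Plancherel's identity** for continuous integrable functions with integrable transform. -/
lemma integrable_norm_sq_and_integral_eq_fourier {q : ℝ → ℂ} (hc : Continuous q)
    (hq : Integrable q) (hf : Integrable (𝓕 q)) :
    Integrable (fun x => ‖q x‖ ^ 2) ∧ ∫ x, ‖q x‖ ^ 2 = ∫ ξ, ‖𝓕 q ξ‖ ^ 2 := by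
  have hinv := hc.fourierInv_fourier_eq hq hf
  constructor
  · have hb : ∀ x, ‖q x‖ ≤ ∫ ξ, ‖𝓕 q ξ‖ := fun x => by
      conv_lhs => rw [← hinv, Real.fourierInv_eq]
      refine (norm_integral_le_integral_norm _).trans (le_of_eq ?_)
      simp
    refine (hq.norm.bdd_mul (c := ∫ ξ, ‖𝓕 q ξ‖) hc.norm.aestronglyMeasurable
      (ae_of_all _ fun x => by simpa using hb x)).congr (ae_of_all _ fun x => ?_)
    simp [sq]
  · have h := VectorFourier.integral_sesq_fourierIntegral_eq_neg_flip (innerSL ℂ (E := ℂ))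
      (L := innerₗ ℝ) (μ := volume) (ν := volume) Real.continuous_fourierChar continuous_inner hq hf
    have h2 : ∫ ξ, inner ℂ (𝓕 q ξ) (𝓕 q ξ) = ∫ x, inner ℂ (q x) (𝓕⁻ (𝓕 q) x) := by
      rw [flip_innerₗ] at h
      exact h
    rw [hinv] at h2
    simp only [inner_self_eq_norm_sq_to_K] at h2
    norm_cast at h2
    have h3 : ((∫ ξ, ‖𝓕 q ξ‖ ^ 2 : ℝ) : ℂ) = ((∫ x, ‖q x‖ ^ 2 : ℝ) : ℂ) := by
      rw [← integral_complex_ofReal, ← integral_complex_ofReal]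
      exact_mod_cast h2
    exact_mod_cast h3.symm

lemma integrable_prod_mul_comp_sub {𝕜 : Type*} [RCLike 𝕜] {μ : Measure ℝ} [SFinite μ]
    {F g : ℝ → 𝕜} (hF : Integrable F) (hg : Integrable g μ) :
    Integrable (fun p : ℝ × ℝ => F (p.1 - p.2) * g p.2) (volume.prod μ) :=
  (measurePreserving_sub_prod volume μ).integrable_comp_of_integrable (hF.mul_prod hg)

lemma fourier_convolution_measure {μ : Measure ℝ} [IsProbabilityMeasure μ] {F : ℝ → ℂ}
    (hF : Integrable F) (ξ : ℝ) :
    𝓕 (fun w => ∫ v, F (w - v) ∂μ) ξ = 𝓕 F ξ * charFun μ (-(2 * π * ξ)) := by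
  have hi : Integrable (fun p : ℝ × ℝ => F (p.1 - p.2)) (volume.prod μ) := by
    simpa using integrable_prod_mul_comp_sub hF (integrable_const (1 : ℂ) (μ := μ))
  have hi2 : Integrable (Function.uncurry fun w v : ℝ => 𝐞 (-(w * ξ)) • F (w - v))
      (volume.prod μ) := by
    refine (integrable_norm_iff ?_).1 (hi.norm.congr (ae_of_all _ fun p => ?_))
    · have : Continuous fun p : ℝ × ℝ => ((𝐞 (-(p.1 * ξ)) : Circle) : ℂ) := by fun_prop
      exact (this.aestronglyMeasurable.mul hi.aestronglyMeasurable).congr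
        (ae_of_all _ fun p => by simp [Function.uncurry, Circle.smul_def])
    · simp [Function.uncurry]
  calc 𝓕 (fun w => ∫ v, F (w - v) ∂μ) ξ
      = ∫ w, ∫ v, 𝐞 (-(w * ξ)) • F (w - v) ∂μ := by
        rw [Real.fourier_real_eq]
        congr 1 with w
        rw [Circle.smul_def, ← integral_smul]
        rfl
    _ = ∫ v, (∫ w, 𝐞 (-(w * ξ)) • F (w - v)) ∂μ := integral_integral_swap hi2
    _ = ∫ v, 𝓕 F ξ * Complex.exp ((-(2 * π * ξ) : ℝ) * v * Complex.I) ∂μ := by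
        congr 1 with v
        rw [Real.fourier_real_eq, mul_comm, ← integral_const_mul,
          ← integral_add_right_eq_self _ v]
        congr 1 with w
        rw [add_sub_cancel_right, Circle.smul_def, Circle.smul_def, smul_eq_mul, smul_eq_mul,
          ← mul_assoc, Real.fourierChar_apply, Real.fourierChar_apply, ← Complex.exp_add]
        congr 2
        push_cast
        ring
    _ = _ := by rw [integral_const_mul, charFun_apply_real]

lemma fourier_comp_div (F : ℝ → ℂ) {h : ℝ} (hh : 0 < h) (ξ : ℝ) :
    𝓕 (fun u => F (u / h)) ξ = h * 𝓕 F (h * ξ) := by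
  have := Measure.integral_comp_div (fun y : ℝ => 𝐞 (-(y * (h * ξ))) • F y) h
  rw [Real.fourier_real_eq, Real.fourier_real_eq]
  rw [abs_of_pos hh] at this
  rw [← Complex.real_smul, ← this]
  congr 1 with x
  congr 3
  field_simp

lemma integrable_inv_one_add_mul_sq {h : ℝ} (hh : 0 < h) :
    Integrable fun ξ : ℝ => (1 + (h * ξ) ^ 2)⁻¹ :=
  integrable_inv_one_add_sq.comp_mul_left' hh.ne'

lemma integral_inv_one_add_mul_sq {h : ℝ} (hh : 0 < h) :
    ∫ ξ : ℝ, (1 + (h * ξ) ^ 2)⁻¹ = π / h := by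
  have := Measure.integral_comp_mul_left (fun y : ℝ => (1 + y ^ 2)⁻¹) h
  rw [this, integral_univ_inv_one_add_sq, abs_of_pos (inv_pos.2 hh), smul_eq_mul]
  ring

/-- Plancherel, with one of the two factors `(1 + (h * ξ) ^ 2)⁻¹` bounded by `1` and the other
integrating to `π / h`. -/
lemma integral_norm_sq_le_of_fourier_le {Q : ℝ → ℂ} (hc : Continuous Q) (hQ : Integrable Q)
    {M h : ℝ} (hh : 0 < h) (hM : ∀ ξ, ‖𝓕 Q ξ‖ ≤ M * (1 + (h * ξ) ^ 2)⁻¹) :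
    Integrable (fun x => ‖Q x‖ ^ 2) ∧ ∫ x, ‖Q x‖ ^ 2 ≤ M ^ 2 * (π / h) := by
  have hE := integrable_inv_one_add_mul_sq hh
  have hcF : Continuous (𝓕 Q) := VectorFourier.fourierIntegral_continuous
    Real.continuous_fourierChar continuous_inner hQ
  have hi : Integrable (𝓕 Q) :=
    (hE.const_mul M).mono' hcF.aestronglyMeasurable (ae_of_all _ hM)
  obtain ⟨h1, h2⟩ := integrable_norm_sq_and_integral_eq_fourier hc hQ hi
  refine ⟨h1, ?_⟩
  have hle : ∀ ξ, ‖𝓕 Q ξ‖ ^ 2 ≤ M ^ 2 * (1 + (h * ξ) ^ 2)⁻¹ := fun ξ => by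
    have h3 : (1 + (h * ξ) ^ 2)⁻¹ ≤ 1 := inv_le_one_of_one_le₀ (by nlinarith [sq_nonneg (h * ξ)])
    have h4 : 0 ≤ (1 + (h * ξ) ^ 2)⁻¹ := by positivity
    calc ‖𝓕 Q ξ‖ ^ 2 ≤ (M * (1 + (h * ξ) ^ 2)⁻¹) ^ 2 := by
          gcongr
          exact hM ξ
      _ = M ^ 2 * ((1 + (h * ξ) ^ 2)⁻¹ * (1 + (h * ξ) ^ 2)⁻¹) := by ring
      _ ≤ M ^ 2 * ((1 + (h * ξ) ^ 2)⁻¹ * 1) := by gcongr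
      _ = _ := by ring
  rw [h2, ← integral_inv_one_add_mul_sq hh, ← integral_const_mul]
  exact integral_mono_of_nonneg (ae_of_all _ fun _ => by positivity) (hE.const_mul _)
    (ae_of_all _ hle)

lemma hasDerivAt_charFun {μ : Measure ℝ} [IsProbabilityMeasure μ] (hμ : Integrable id μ) (t : ℝ) :
    HasDerivAt (charFun μ) (deriv (charFun μ) t) t :=
  ((contDiff_charFun (n := 1) (by simpa using memLp_one_iff_integrable.2 hμ)).differentiable
    (by simp) t).hasDerivAt

lemma deriv_charFun_eq {μ : Measure ℝ} [IsProbabilityMeasure μ] (hμ : Integrable id μ) (t : ℝ) :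
    deriv (charFun μ) t = Complex.I * ∫ x, x * Complex.exp (t * x * Complex.I) ∂μ := by
  have := iteratedDeriv_charFun (μ := μ) (n := 1) (t := t)
    (by simpa using memLp_one_iff_integrable.2 hμ)
  simpa using this

lemma norm_deriv_charFun_le {μ : Measure ℝ} [IsProbabilityMeasure μ] (hμ : Integrable id μ)
    (t : ℝ) : ‖deriv (charFun μ) t‖ ≤ ∫ x, |x| ∂μ := by
  rw [deriv_charFun_eq hμ, norm_mul, Complex.norm_I, one_mul]
  refine (norm_integral_le_integral_norm _).trans (le_of_eq ?_)
  congr 1 with x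
  rw [norm_mul, show (t : ℂ) * x * Complex.I = ((t * x : ℝ) : ℂ) * Complex.I by push_cast; ring,
    Complex.norm_exp_ofReal_mul_I]
  simp

/-- The law `μ` has a first moment, and its characteristic function and the derivative of the
latter decay polynomially. -/
structure CharFunDecay (μ : Measure ℝ) (γ ω₀ B₂ B : ℝ) : Prop where
  integrable_id : Integrable id μ
  upper : ∀ t : ℝ, ω₀ ≤ |t| → ‖charFun μ t‖ ≤ B₂ * |t| ^ (-γ)
  deriv_upper : ∀ t : ℝ, ω₀ ≤ |t| → ‖deriv (charFun μ) t‖ ≤ B * |t| ^ (-γ)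

lemma rpow_mul_le_of_le_mul_rpow_neg {x y c γ : ℝ} (hx : 0 < x) (h : y ≤ c * x ^ (-γ)) :
    x ^ γ * y ≤ c := by
  calc x ^ γ * y ≤ x ^ γ * (c * x ^ (-γ)) := by gcongr
    _ = c * (x ^ γ * x ^ (-γ)) := by ring
    _ = c := by rw [← Real.rpow_add hx, add_neg_cancel, Real.rpow_zero, mul_one]

lemma le_abs_two_pi_mul (ξ : ℝ) : |ξ| ≤ |-(2 * π * ξ)| := by
  rw [abs_neg, abs_mul, abs_of_pos Real.two_pi_pos]
  exact le_mul_of_one_le_left (abs_nonneg _) (by linarith [Real.pi_gt_three])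

/-- A bump of bandwidth `h`, smoothed by a law with polynomially decaying characteristic function,
has weighted squared norm of order `h ^ (2 γ + 1)`. -/
lemma exists_weighted_integral_sq_le {γ ω₀ B₂ B : ℝ} (hγ : 0 < γ) (hω₀ : 0 < ω₀) (hB₂ : 0 ≤ B₂)
    (hB : 0 ≤ B) {k : ℝ → ℝ} (hk : Continuous k) (hs : HasCompactSupport k) {C : ℝ} (hC0 : 0 ≤ C)
    (hC : ∀ ξ : ℝ,
        ‖𝓕 (fun u => (k u : ℂ)) ξ‖ ≤ C * (|ξ| ^ γ * (1 + ξ ^ 2)⁻¹) ∧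
        ‖𝓕 (fun u => (k u : ℂ)) ξ‖ ≤ C * (|ξ| ^ (γ + 1) * (1 + ξ ^ 2)⁻¹) ∧
        ‖deriv (𝓕 (fun u => (k u : ℂ))) ξ‖ ≤ C * (|ξ| ^ γ * (1 + ξ ^ 2)⁻¹)) :
    ∃ D : ℝ, 0 < D ∧ ∀ μ : Measure ℝ, IsProbabilityMeasure μ → CharFunDecay μ γ ω₀ B₂ B →
      ∃ h₀ : ℝ, 0 < h₀ ∧ ∀ h : ℝ, 0 < h → h ≤ h₀ →
        Integrable (fun w => (1 + w ^ 2) * (∫ v, k ((w - v) / h) ∂μ) ^ 2) ∧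
        ∫ w, (1 + w ^ 2) * (∫ v, k ((w - v) / h) ∂μ) ^ 2 ≤ D * h ^ (2 * γ + 1) := by
  set C' := B₂ + ω₀ ^ γ with hC'
  have hC'0 : 0 ≤ C' := by positivity
  set D₁ := C * C' + 2 * π * (C * (B + 1)) with hD₁
  have hD₁0 : 0 ≤ D₁ := by positivity
  refine ⟨2 * π * D₁ ^ 2 + 1, by positivity, fun μ hμ hdec => ?_⟩
  set m := ∫ x, |x| ∂μ with hm
  have hm0 : 0 ≤ m := integral_nonneg fun _ => abs_nonneg _
  -- The first moment `m` of `μ` is not controlled by the decay constants, so it may enter `h₀` but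
  -- not `D`. This choice gives `h * (ω₀ ^ (γ + 1) * m) ≤ 1`.
  refine ⟨min 1 (ω₀ ^ (γ + 1) * m + 1)⁻¹, by positivity, fun h hh hhle => ?_⟩
  have hh1 : h ≤ 1 := hhle.trans (min_le_left _ _)
  have hh2 : h * (ω₀ ^ (γ + 1) * m) ≤ 1 := by
    have h1 : h ≤ (ω₀ ^ (γ + 1) * m + 1)⁻¹ := hhle.trans (min_le_right _ _)
    have h2 : 0 ≤ ω₀ ^ (γ + 1) * m := by positivity
    calc h * (ω₀ ^ (γ + 1) * m) ≤ (ω₀ ^ (γ + 1) * m + 1)⁻¹ * (ω₀ ^ (γ + 1) * m + 1) := by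
          gcongr
          linarith
      _ = 1 := inv_mul_cancel₀ (by positivity)
  -- bounds on the characteristic function
  have hχ : ∀ ξ : ℝ, |ξ| ^ γ * ‖charFun μ (-(2 * π * ξ))‖ ≤ C' := fun ξ => by
    set t := -(2 * π * ξ) with ht
    have h1 : |ξ| ≤ |t| := le_abs_two_pi_mul ξ
    refine (mul_le_mul_of_nonneg_right (Real.rpow_le_rpow (abs_nonneg _) h1 hγ.le)
      (norm_nonneg _)).trans ?_
    rcases le_total ω₀ |t| with h2 | h2
    · refine (rpow_mul_le_of_le_mul_rpow_neg (hω₀.trans_le h2) (hdec.upper t h2)).trans ?_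
      linarith [Real.rpow_nonneg hω₀.le γ]
    · calc |t| ^ γ * ‖charFun μ t‖ ≤ ω₀ ^ γ * 1 := by
            gcongr
            exact norm_charFun_le_one t
        _ ≤ C' := by linarith
  -- At low frequencies the derivative is bounded only by `m`. The second alternative asks for an
  -- extra power of `|ξ|`, supplied by the bound of order `γ + 1` on the transform of `k`; the
  -- factor `h` that comes with it absorbs `m`.
  have hχ' : ∀ ξ : ℝ, |ξ| ^ γ * ‖deriv (charFun μ) (-(2 * π * ξ))‖ ≤ B ∨
      |ξ| ^ (γ + 1) * ‖deriv (charFun μ) (-(2 * π * ξ))‖ ≤ ω₀ ^ (γ + 1) * m := fun ξ => by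
    set t := -(2 * π * ξ) with ht
    have h1 : |ξ| ≤ |t| := le_abs_two_pi_mul ξ
    rcases le_total ω₀ |t| with h2 | h2
    · left
      refine (mul_le_mul_of_nonneg_right (Real.rpow_le_rpow (abs_nonneg _) h1 hγ.le)
        (norm_nonneg _)).trans ?_
      exact rpow_mul_le_of_le_mul_rpow_neg (hω₀.trans_le h2) (hdec.deriv_upper t h2)
    · right
      gcongr
      · exact h1.trans h2
      · exact norm_deriv_charFun_le hdec.integrable_id t
  -- the smoothed bump
  set F : ℝ → ℂ := fun u => (k (u / h) : ℂ) with hF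
  have hFc : Continuous F := by fun_prop
  have hk0 : Integrable fun u => (k u : ℂ) := (hk.integrable_of_hasCompactSupport hs).ofReal
  have hF0 : Integrable F := hk0.comp_div hh.ne'
  have hF1 : Integrable fun u : ℝ => (u : ℂ) * F u := by
    have h1 : Integrable fun u : ℝ => (u : ℂ) * (k u : ℂ) := by
      have : Integrable fun u : ℝ => ((u * k u : ℝ) : ℂ) :=
      ((continuous_id.mul hk).integrable_of_hasCompactSupport hs.mul_left).ofReal
      simpa using this
    refine ((h1.comp_div hh.ne').const_mul (h : ℂ)).congr (ae_of_all _ fun u => ?_)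
    have : (h : ℂ) ≠ 0 := by exact_mod_cast hh.ne'
    simp only [hF]
    push_cast
    field_simp
  obtain ⟨Ck, hCk⟩ := hk.bounded_above_of_compact_support hs
  set q : ℝ → ℂ := fun w => ∫ v, F (w - v) ∂μ with hq
  have hqr : ∀ w, q w = ((∫ v, k ((w - v) / h) ∂μ : ℝ) : ℂ) := fun w => integral_ofReal
  have hqc : Continuous q := by
    refine continuous_of_dominated (bound := fun _ => Ck)
      (fun w => (hFc.comp (continuous_const.sub continuous_id)).aestronglyMeasurable)
      (fun w => ae_of_all _ fun v => ?_) (integrable_const _) (ae_of_all _ fun v => by fun_prop)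
    simpa [hF] using hCk ((w - v) / h)
  have hqi : Integrable q := by
    have := (integrable_prod_mul_comp_sub hF0 (integrable_const (1 : ℂ) (μ := μ))).integral_prod_left
    simpa using this
  have hwq : Integrable fun w : ℝ => (w : ℂ) * q w := by
    have h1 := (integrable_prod_mul_comp_sub hF1 (integrable_const (1 : ℂ) (μ := μ)))
    have hv : Integrable (fun v : ℝ => (v : ℂ)) μ := hdec.integrable_id.ofReal
    have h2 := integrable_prod_mul_comp_sub hF0 hv
    refine (h1.add h2).integral_prod_left.congr (ae_of_all _ fun w => ?_)
    simp only [hq]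
    rw [← integral_const_mul]
    congr 1 with v
    simp only [Pi.add_apply]
    push_cast [mul_one]
    ring
  -- its Fourier transform
  set k' : ℝ → ℂ := fun u => (k u : ℂ) with hk'
  have hu1 : Integrable fun u : ℝ => u • k' u := by
    have : Integrable fun u : ℝ => ((u * k u : ℝ) : ℂ) :=
      ((continuous_id.mul hk).integrable_of_hasCompactSupport hs.mul_left).ofReal
    simpa [hk'] using this
  have hFq : 𝓕 q = fun ξ => h * 𝓕 k' (h * ξ) * charFun μ (-(2 * π * ξ)) := by
    ext ξ
    rw [hq, fourier_convolution_measure hF0, hF, fourier_comp_div (fun u => (k u : ℂ)) hh]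
  have hdFq : ∀ ξ, HasDerivAt (𝓕 q) (h * (deriv (𝓕 k') (h * ξ) * h) * charFun μ (-(2 * π * ξ)) +
      h * 𝓕 k' (h * ξ) * (deriv (charFun μ) (-(2 * π * ξ)) * (-(2 * π)))) ξ := fun ξ => by
    have h1 : HasDerivAt (𝓕 k') (deriv (𝓕 k') (h * ξ)) (h * ξ) :=
      (Real.hasDerivAt_fourier hk0 hu1 (h * ξ)).differentiableAt.hasDerivAt
    have h2 : HasDerivAt (fun ξ : ℝ => h * ξ) h ξ := by
      simpa using (hasDerivAt_id ξ).const_mul h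
    have h3 : HasDerivAt (fun ξ : ℝ => -(2 * π * ξ)) (-(2 * π)) ξ := by
      simpa using ((hasDerivAt_id ξ).const_mul (2 * π)).fun_neg
    have h4 := h1.scomp ξ h2
    have h5 := (hasDerivAt_charFun hdec.integrable_id (-(2 * π * ξ))).scomp ξ h3
    rw [hFq]
    refine ((h4.const_mul (h : ℂ)).fun_mul h5).congr_deriv ?_
    simp only [Complex.real_smul, Function.comp_apply]
    push_cast
    ring
  have hE : ∀ ξ, |h * ξ| ^ γ = h ^ γ * |ξ| ^ γ := fun ξ => by
    rw [abs_mul, abs_of_pos hh, Real.mul_rpow hh.le (abs_nonneg _)]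
  have hE' : ∀ ξ, |h * ξ| ^ (γ + 1) = h ^ γ * h * |ξ| ^ (γ + 1) := fun ξ => by
    rw [abs_mul, abs_of_pos hh, Real.mul_rpow hh.le (abs_nonneg _), Real.rpow_add_one hh.ne']
  have hhγ : 0 < h ^ γ := by positivity
  have hb1 : ∀ ξ, ‖h * 𝓕 k' (h * ξ) * charFun μ (-(2 * π * ξ))‖ ≤
      C * C' * (h * h ^ γ) * (1 + (h * ξ) ^ 2)⁻¹ := fun ξ => by
    rw [norm_mul, norm_mul, Complex.norm_real, Real.norm_of_nonneg hh.le]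
    calc h * ‖𝓕 k' (h * ξ)‖ * ‖charFun μ (-(2 * π * ξ))‖
        ≤ h * (C * (|h * ξ| ^ γ * (1 + (h * ξ) ^ 2)⁻¹)) * ‖charFun μ (-(2 * π * ξ))‖ := by
          gcongr
          exact (hC _).1
      _ = h * C * h ^ γ * (1 + (h * ξ) ^ 2)⁻¹ * (|ξ| ^ γ * ‖charFun μ (-(2 * π * ξ))‖) := by
          rw [hE]; ring
      _ ≤ h * C * h ^ γ * (1 + (h * ξ) ^ 2)⁻¹ * C' := by
          gcongr
          exact hχ ξ
      _ = _ := by ring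
  have hb2 : ∀ ξ, ‖h * (deriv (𝓕 k') (h * ξ) * h) * charFun μ (-(2 * π * ξ))‖ ≤
      C * C' * (h * h ^ γ) * (1 + (h * ξ) ^ 2)⁻¹ := fun ξ => by
    rw [norm_mul, norm_mul, norm_mul, Complex.norm_real, Real.norm_of_nonneg hh.le]
    calc h * (‖deriv (𝓕 k') (h * ξ)‖ * h) * ‖charFun μ (-(2 * π * ξ))‖
        ≤ h * ((C * (|h * ξ| ^ γ * (1 + (h * ξ) ^ 2)⁻¹)) * 1) *
            ‖charFun μ (-(2 * π * ξ))‖ := by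
          gcongr
          exact (hC _).2.2
      _ = h * C * h ^ γ * (1 + (h * ξ) ^ 2)⁻¹ * (|ξ| ^ γ * ‖charFun μ (-(2 * π * ξ))‖) := by
          rw [hE]; ring
      _ ≤ h * C * h ^ γ * (1 + (h * ξ) ^ 2)⁻¹ * C' := by
          gcongr
          exact hχ ξ
      _ = _ := by ring
  have hb3 : ∀ ξ, ‖h * 𝓕 k' (h * ξ)‖ * ‖deriv (charFun μ) (-(2 * π * ξ))‖ ≤
      C * (B + 1) * (h * h ^ γ) * (1 + (h * ξ) ^ 2)⁻¹ := fun ξ => by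
    rw [norm_mul, Complex.norm_real, Real.norm_of_nonneg hh.le]
    set X := ‖deriv (charFun μ) (-(2 * π * ξ))‖ with hX
    have hX0 : 0 ≤ X := norm_nonneg _
    rcases hχ' ξ with h1 | h1
    · calc h * ‖𝓕 k' (h * ξ)‖ * X
          ≤ h * (C * (|h * ξ| ^ γ * (1 + (h * ξ) ^ 2)⁻¹)) * X := by
            gcongr
            exact (hC _).1
        _ = h * C * h ^ γ * (1 + (h * ξ) ^ 2)⁻¹ * (|ξ| ^ γ * X) := by
            rw [hE]; ring
        _ ≤ h * C * h ^ γ * (1 + (h * ξ) ^ 2)⁻¹ * (B + 1) :=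
            mul_le_mul_of_nonneg_left (by linarith) (by positivity)
        _ = _ := by ring
    · calc h * ‖𝓕 k' (h * ξ)‖ * X
          ≤ h * (C * (|h * ξ| ^ (γ + 1) * (1 + (h * ξ) ^ 2)⁻¹)) * X := by
            gcongr
            exact (hC _).2.1
        _ = h * C * h ^ γ * (1 + (h * ξ) ^ 2)⁻¹ * (h * (|ξ| ^ (γ + 1) * X)) := by
            rw [hE']; ring
        _ ≤ h * C * h ^ γ * (1 + (h * ξ) ^ 2)⁻¹ * (B + 1) := by
            refine mul_le_mul_of_nonneg_left ?_ (by positivity)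
            have := mul_le_mul_of_nonneg_left h1 hh.le
            linarith
        _ = _ := by ring
  have hB1 : ∀ ξ, ‖𝓕 q ξ‖ ≤ D₁ * (h * h ^ γ) * (1 + (h * ξ) ^ 2)⁻¹ := fun ξ => by
    rw [hFq]
    refine (hb1 ξ).trans ?_
    gcongr
    exact le_add_of_nonneg_right (by positivity)
  -- Multiplication by `x` becomes differentiation of `𝓕 q`. The product rule yields one term with
  -- the derivative of `𝓕 k'` and one with that of the characteristic function.
  have hB2 : ∀ ξ, ‖𝓕 (fun x : ℝ => (-2 * π * Complex.I * x) • q x) ξ‖ ≤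
      D₁ * (h * h ^ γ) * (1 + (h * ξ) ^ 2)⁻¹ := fun ξ => by
    have hxq : Integrable fun x : ℝ => x • q x := by simpa using hwq
    rw [(Real.hasDerivAt_fourier hqi hxq ξ).unique (hdFq ξ)]
    refine (norm_add_le _ _).trans ?_
    rw [norm_mul (h * 𝓕 k' (h * ξ)), norm_mul (deriv (charFun μ) _)]
    have h2π : ‖(-(2 * π) : ℂ)‖ = 2 * π := by simp [abs_of_pos Real.pi_pos]
    rw [h2π]
    calc _ ≤ C * C' * (h * h ^ γ) * (1 + (h * ξ) ^ 2)⁻¹ +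
          2 * π * (C * (B + 1) * (h * h ^ γ) * (1 + (h * ξ) ^ 2)⁻¹) := by
          refine add_le_add (hb2 ξ) ?_
          rw [← mul_assoc, mul_comm]
          exact mul_le_mul_of_nonneg_left (hb3 ξ) (by positivity)
      _ = _ := by rw [hD₁]; ring
  obtain ⟨hI1, hJ1⟩ := integral_norm_sq_le_of_fourier_le hqc hqi hh hB1
  obtain ⟨hI2, hJ2⟩ := integral_norm_sq_le_of_fourier_le
    (Q := fun x : ℝ => (-2 * π * Complex.I * x) • q x) (by fun_prop)
    ((hwq.const_mul (-2 * π * Complex.I)).congr (ae_of_all _ fun x => by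
      simp only [smul_eq_mul]; ring)) hh hB2
  have hn1 : ∀ w, ‖q w‖ ^ 2 = (∫ v, k ((w - v) / h) ∂μ) ^ 2 := fun w => by
    rw [hqr, Complex.norm_real, Real.norm_eq_abs, sq_abs]
  have hn2 : ∀ w : ℝ, ‖(-2 * π * Complex.I * w) • q w‖ ^ 2 =
      (2 * π) ^ 2 * (w ^ 2 * (∫ v, k ((w - v) / h) ∂μ) ^ 2) := fun w => by
    rw [norm_smul, mul_pow, hn1]
    simp [abs_of_pos Real.pi_pos, mul_pow]
    ring
  simp only [hn1] at hI1 hJ1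
  simp only [hn2] at hI2 hJ2
  rw [integral_const_mul] at hJ2
  have h2π : (1 : ℝ) ≤ (2 * π) ^ 2 := one_le_pow₀ (by linarith [Real.pi_gt_three])
  have hI3 : Integrable fun w : ℝ => w ^ 2 * (∫ v, k ((w - v) / h) ∂μ) ^ 2 :=
    (integrable_const_mul_iff (by simp [Real.pi_ne_zero]) _).1 hI2
  have hJ3 : ∫ w : ℝ, w ^ 2 * (∫ v, k ((w - v) / h) ∂μ) ^ 2 ≤ (D₁ * (h * h ^ γ)) ^ 2 * (π / h) := by
    refine le_trans ?_ hJ2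
    exact le_mul_of_one_le_left (integral_nonneg fun _ => by positivity) h2π
  have hsplit : (fun w : ℝ => (1 + w ^ 2) * (∫ v, k ((w - v) / h) ∂μ) ^ 2) =
      fun w => (∫ v, k ((w - v) / h) ∂μ) ^ 2 + w ^ 2 * (∫ v, k ((w - v) / h) ∂μ) ^ 2 := by
    ext w; ring
  rw [hsplit]
  refine ⟨hI1.add hI3, ?_⟩
  rw [integral_add hI1 hI3]
  have hpow : h ^ (2 * γ + 1) = h * (h ^ γ) ^ 2 := by
    rw [Real.rpow_add_one hh.ne', mul_comm 2 γ, Real.rpow_mul hh.le]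
    norm_num
    ring
  calc _ ≤ (D₁ * (h * h ^ γ)) ^ 2 * (π / h) + (D₁ * (h * h ^ γ)) ^ 2 * (π / h) :=
        add_le_add hJ1 hJ3
    _ = 2 * π * D₁ ^ 2 * h ^ (2 * γ + 1) := by
        rw [hpow]; field_simp; ring
    _ ≤ _ := by gcongr; linarith

end Fourier

/-! ### A compact interval charged uniformly by the admissible laws -/

/-- Laws whose characteristic function has polynomial decay of a given exact order, with a
derivative of the same order, charge a common compact interval. -/
lemma exists_measureReal_Icc_ge {γ ω₀ B₁ B₂ B : ℝ} (hγ : 0 < γ) (hω₀ : 0 < ω₀) (hB₁ : 0 < B₁)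
    (hB : 0 ≤ B) :
    ∃ M c : ℝ, 0 < c ∧ ∀ μ : Measure ℝ, IsProbabilityMeasure μ → CharFunDecay μ γ ω₀ B₂ B →
      (∀ ω : ℝ, ω₀ ≤ |ω| → B₁ * |ω| ^ (-γ) ≤ ‖charFun μ ω‖) → c ≤ μ.real (Icc (-M) M) := by
  set b := ω₀ + 1 with hb
  have hab : ω₀ < b := by linarith
  -- Here `β` is a weight on `[ω₀, ω₀ + 1]`, not a smoothness index. Its zeros at the endpoints
  -- remove the boundary terms from the integration by parts below.
  set β : ℝ → ℝ := fun t => (t - ω₀) * (b - t) with hβ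
  have hβc : Continuous β := by fun_prop
  have hβ0 : ∀ t ∈ Icc ω₀ b, 0 ≤ β t := fun t ht =>
    mul_nonneg (by linarith [ht.1]) (by linarith [ht.2])
  have hβ1 : ∀ t ∈ Icc ω₀ b, β t ≤ 1 := fun t ht =>
    mul_le_one₀ (by linarith [ht.2]) (by linarith [ht.2]) (by linarith [ht.1])
  have hβ' : ∀ t, HasDerivAt β (ω₀ + b - 2 * t) t := fun t => by
    refine (((hasDerivAt_id t).sub_const ω₀).mul ((hasDerivAt_id t).const_sub b)).congr_deriv ?_
    simp only [id]; ring
  set J := ∫ t in ω₀..b, β t with hJ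
  have hJ0 : 0 < J := intervalIntegral.intervalIntegral_pos_of_pos_on
    (hβc.intervalIntegrable _ _) (fun t ht => mul_pos (by linarith [ht.1]) (by linarith [ht.2])) hab
  set L := 1 + B * ω₀ ^ (-γ) with hL
  have hL0 : 0 < L := by positivity
  set c₀ := (B₁ * b ^ (-γ)) ^ 2 * J with hc₀
  have hb0 : 0 < b := by positivity
  have hc₀0 : 0 < c₀ := by positivity
  refine ⟨2 * L / c₀, c₀ / 2, by positivity, fun μ hμ hdec hlow => ?_⟩
  set M := 2 * L / c₀ with hM
  have hM0 : 0 < M := by positivity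
  have hder := hasDerivAt_charFun hdec.integrable_id
  have hχc : Continuous (charFun μ) :=
    continuous_iff_continuousAt.2 fun t => (hder t).continuousAt
  have hχ'c : Continuous (deriv (charFun μ)) :=
    (contDiff_charFun (n := 1) (by simpa using memLp_one_iff_integrable.2 hdec.integrable_id)
      ).continuous_deriv (by simp)
  -- Since `charFun μ (-t)` is the conjugate of `charFun μ t`, the function `G v = ∫ H t * exp (i t
  -- v) dt` has `μ`-mean `∫ β * ‖charFun μ‖ ^ 2 ≥ c₀`. Also `‖G v‖ ≤ min 1 (L / |v|)`. If `μ`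
  -- charged `[-M, M]` too little, this mean would be too small; `M` is chosen so that `L / M = c₀ /
  -- 2`.
  set H : ℝ → ℂ := fun t => β t * charFun μ (-t) with hH
  set H' : ℝ → ℂ := fun t => (ω₀ + b - 2 * t : ℝ) * charFun μ (-t) +
    β t * -deriv (charFun μ) (-t) with hH'
  have hHc : Continuous H := by fun_prop
  have hH'c : Continuous H' := by fun_prop
  have hHd : ∀ t, HasDerivAt H (H' t) t := fun t => by
    have h1 : HasDerivAt (fun t => charFun μ (-t)) (-deriv (charFun μ) (-t)) t := by
      exact ((hder (-t)).scomp t (hasDerivAt_neg t)).congr_deriv (by simp)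
    exact ((hβ' t).ofReal_comp).fun_mul h1
  have hHn : ∀ t ∈ Icc ω₀ b, ‖H t‖ ≤ 1 := fun t ht => by
    simp only [hH, norm_mul, Complex.norm_real, Real.norm_of_nonneg (hβ0 t ht)]
    exact mul_le_one₀ (hβ1 t ht) (norm_nonneg _) (norm_charFun_le_one _)
  have hH'n : ∀ t ∈ Icc ω₀ b, ‖H' t‖ ≤ L := fun t ht => by
    have ht0 : 0 < t := hω₀.trans_le ht.1
    refine (norm_add_le _ _).trans (add_le_add ?_ ?_)
    · rw [norm_mul, Complex.norm_real, Real.norm_eq_abs]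
      refine mul_le_one₀ (abs_le.2 ⟨?_, ?_⟩) (norm_nonneg _) (norm_charFun_le_one _)
      · linarith [ht.2]
      · linarith [ht.1]
    · rw [norm_mul, norm_neg, Complex.norm_real, Real.norm_of_nonneg (hβ0 t ht)]
      have h1 := hdec.deriv_upper (-t) (by rw [abs_neg, abs_of_pos ht0]; exact ht.1)
      rw [abs_neg, abs_of_pos ht0] at h1
      calc β t * ‖deriv (charFun μ) (-t)‖ ≤ 1 * (B * t ^ (-γ)) :=
            mul_le_mul (hβ1 t ht) h1 (norm_nonneg _) zero_le_one
        _ ≤ B * ω₀ ^ (-γ) := by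
            rw [one_mul]
            exact mul_le_mul_of_nonneg_left
              (Real.rpow_le_rpow_of_nonpos hω₀ ht.1 (by linarith)) hB
  set e : ℝ → ℝ → ℂ := fun t v => Complex.exp (t * v * Complex.I) with he
  have hen : ∀ t v, ‖e t v‖ = 1 := fun t v => by
    simp only [he]
    rw [show (t : ℂ) * v * Complex.I = ((t * v : ℝ) : ℂ) * Complex.I by push_cast; ring,
      Complex.norm_exp_ofReal_mul_I]
  set G : ℝ → ℂ := fun v => ∫ t in ω₀..b, H t * e t v with hG
  have hIoc : ∀ t ∈ uIoc ω₀ b, t ∈ Icc ω₀ b := fun t ht => by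
    rw [uIoc_of_le hab.le] at ht
    exact ⟨ht.1.le, ht.2⟩
  have hb1 : b - ω₀ = 1 := by rw [hb]; ring
  have hG1 : ∀ v, ‖G v‖ ≤ 1 := fun v => by
    have := intervalIntegral.norm_integral_le_of_norm_le_const (a := ω₀) (b := b) (C := 1)
      (f := fun t => H t * e t v)
      (fun t ht => by rw [norm_mul, hen, mul_one]; exact hHn t (hIoc t ht))
    simpa [hb1] using this
  have hG2 : ∀ v, |v| * ‖G v‖ ≤ L := fun v => by
    have hed : ∀ t : ℝ, HasDerivAt (fun t => e t v) (e t v * (v * Complex.I)) t := fun t => by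
      have h1 : HasDerivAt (fun t : ℝ => (t : ℂ) * v * Complex.I) (v * Complex.I) t := by
        simpa using ((hasDerivAt_id t).ofReal_comp.mul_const (v : ℂ)).mul_const Complex.I
      exact h1.cexp
    have hparts := intervalIntegral.integral_mul_deriv_eq_deriv_mul (a := ω₀) (b := b)
      (u := H) (v := fun t => e t v) (u' := H') (v' := fun t => e t v * (v * Complex.I))
      (fun t _ => hHd t) (fun t _ => hed t) (hH'c.intervalIntegrable _ _)
      ((by simp only [he]; fun_prop : Continuous fun t => e t v * (v * Complex.I)).intervalIntegrable
        _ _)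
    have hHa : H ω₀ = 0 := by simp [hH, hβ]
    have hHb : H b = 0 := by simp [hH, hβ]
    rw [hHa, hHb, zero_mul, zero_mul, sub_zero, zero_sub] at hparts
    have hGv : G v * (v * Complex.I) = -∫ t in ω₀..b, H' t * e t v := by
      rw [← hparts, hG, ← intervalIntegral.integral_mul_const]
      congr 1 with t
      ring
    have h2 : ‖G v * (v * Complex.I)‖ ≤ L := by
      rw [hGv, norm_neg]
      have := intervalIntegral.norm_integral_le_of_norm_le_const (a := ω₀) (b := b) (C := L)
        (f := fun t => H' t * e t v)
        (fun t ht => by rw [norm_mul, hen, mul_one]; exact hH'n t (hIoc t ht))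
      simpa [hb1] using this
    calc |v| * ‖G v‖ = ‖G v * (v * Complex.I)‖ := by simp [mul_comm]
      _ ≤ L := h2
  have hcont : Continuous fun p : ℝ × ℝ => H p.1 * e p.1 p.2 := by
    simp only [he]; fun_prop
  have hswap : ∫ v, G v ∂μ = ∫ t in ω₀..b, H t * charFun μ t := by
    simp only [hG, intervalIntegral.integral_of_le hab.le]
    rw [integral_integral_swap]
    · congr 1 with t
      rw [integral_const_mul, charFun_apply_real]
    · have h1 : Integrable (fun p : ℝ × ℝ => H p.1 * e p.1 p.2)
          ((volume.restrict (Ioc ω₀ b)).prod μ) := by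
        refine Integrable.of_bound hcont.aestronglyMeasurable 1 ?_
        have h2 : ∀ᵐ t ∂volume.restrict (Ioc ω₀ b), ‖H t‖ ≤ 1 := by
          filter_upwards [ae_restrict_mem measurableSet_Ioc] with t ht
          exact hHn t ⟨ht.1.le, ht.2⟩
        filter_upwards [Measure.quasiMeasurePreserving_fst.ae h2] with p hp
        rwa [norm_mul, hen, mul_one]
      exact h1.swap
  have hGc : Continuous G := by
    refine intervalIntegral.continuous_parametric_intervalIntegral_of_continuous' ?_ _ _
    exact hcont.comp continuous_swap
  have hlower : c₀ ≤ ‖∫ v, G v ∂μ‖ := by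
    have h1 : ∀ t, H t * charFun μ t = ((β t * ‖charFun μ t‖ ^ 2 : ℝ) : ℂ) := fun t => by
      simp only [hH]
      rw [charFun_neg, mul_assoc, Complex.conj_mul']
      push_cast
      ring
    rw [hswap]
    simp only [h1]
    rw [intervalIntegral.integral_ofReal, Complex.norm_real]
    refine le_trans ?_ (le_abs_self _)
    rw [hc₀, hJ, ← intervalIntegral.integral_const_mul]
    refine intervalIntegral.integral_mono_on hab.le
      ((continuous_const.mul hβc).intervalIntegrable _ _)
      ((hβc.mul (hχc.norm.pow 2)).intervalIntegrable _ _) fun t ht => ?_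
    have ht0 : 0 < t := hω₀.trans_le ht.1
    have h2 := hlow t (by rw [abs_of_pos ht0]; exact ht.1)
    rw [abs_of_pos ht0] at h2
    have h3 : b ^ (-γ) ≤ t ^ (-γ) := Real.rpow_le_rpow_of_nonpos ht0 ht.2 (by linarith)
    rw [mul_comm]
    refine mul_le_mul_of_nonneg_left ?_ (hβ0 t ht)
    gcongr
    exact (mul_le_mul_of_nonneg_left h3 hB₁.le).trans h2
  have hpt : ∀ v, ‖G v‖ ≤ (Icc (-M) M).indicator 1 v + L / M := fun v => by
    by_cases hv : v ∈ Icc (-M) M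
    · rw [indicator_of_mem hv, Pi.one_apply]
      linarith [hG1 v, show 0 ≤ L / M by positivity]
    · rw [indicator_of_notMem hv, zero_add, le_div_iff₀ hM0, mul_comm]
      have h1 : M ≤ |v| := by
        by_contra! h2
        exact hv ⟨(abs_lt.1 h2).1.le, (abs_lt.1 h2).2.le⟩
      exact (mul_le_mul_of_nonneg_right h1 (norm_nonneg _)).trans (hG2 v)
  have hind : Integrable ((Icc (-M) M).indicator (1 : ℝ → ℝ)) μ :=
    (integrable_const (1 : ℝ)).indicator measurableSet_Icc
  have hupper : ∫ v, ‖G v‖ ∂μ ≤ μ.real (Icc (-M) M) + L / M := by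
    calc ∫ v, ‖G v‖ ∂μ ≤ ∫ v, ((Icc (-M) M).indicator 1 v + L / M) ∂μ :=
          integral_mono_of_nonneg (ae_of_all _ fun _ => norm_nonneg _)
            (hind.add (integrable_const _)) (ae_of_all _ hpt)
      _ = _ := by
          rw [integral_add hind (integrable_const _), integral_indicator_one measurableSet_Icc]
          simp
  have hLM : L / M = c₀ / 2 := by rw [hM]; field_simp
  linarith [norm_integral_le_integral_norm (μ := μ) G]

/-! ### Passing to the logarithmic coordinate -/

section LogCoordinate

open scoped Real

/-- The density of `x₀ * exp U` when `U` has density `ρ`. -/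
noncomputable def logDensity (x₀ : ℝ) (ρ : ℝ → ℝ) (x : ℝ) : ℝ :=
  (Ioi 0).indicator (fun x => ρ (Real.log (x / x₀)) / x) x

lemma measurable_logDensity {x₀ : ℝ} {ρ : ℝ → ℝ} (hρ : Measurable ρ) :
    Measurable (logDensity x₀ ρ) :=
  Measurable.indicator (by fun_prop) measurableSet_Ioi

/-- Change of variables `x = x₀ * exp u`, whose Jacobian cancels the `1 / x` in `logDensity`. -/
lemma lintegral_densityMeasure_logDensity {x₀ : ℝ} (hx₀ : 0 < x₀) {ρ : ℝ → ℝ} (hρ : Measurable ρ)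
    {F : ℝ → ℝ≥0∞} (hF : Measurable F) :
    ∫⁻ x, F x ∂densityMeasure (logDensity x₀ ρ) =
      ∫⁻ u, ENNReal.ofReal (ρ u) * F (x₀ * Real.exp u) := by
  have himg : (fun u => x₀ * Real.exp u) '' univ = Ioi 0 := by
    ext x
    simp only [image_univ, mem_range, mem_Ioi]
    refine ⟨fun ⟨u, hu⟩ => hu ▸ by positivity, fun hx => ⟨Real.log (x / x₀), ?_⟩⟩
    rw [Real.exp_log (by positivity)]
    field_simp
  have hinj : InjOn (fun u => x₀ * Real.exp u) univ := fun a _ b _ h =>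
    Real.exp_injective (mul_left_cancel₀ hx₀.ne' h)
  have h0 : ∀ x ∉ Ioi (0 : ℝ), ENNReal.ofReal (logDensity x₀ ρ x) * F x = 0 := fun x hx => by
    simp [logDensity, indicator_of_notMem hx]
  rw [densityMeasure, lintegral_withDensity_eq_lintegral_mul _
    (measurable_logDensity hρ).ennreal_ofReal hF]
  simp only [Pi.mul_apply]
  rw [← setLIntegral_eq_of_support_subset (s := Ioi 0)
    (fun x hx => by_contra fun h => hx (h0 x h)), ← himg,
    lintegral_image_eq_lintegral_abs_deriv_mul MeasurableSet.univ
      (fun u _ => ((Real.hasDerivAt_exp u).const_mul x₀).hasDerivWithinAt) hinj, setLIntegral_univ]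
  congr 1 with u
  have hpos : 0 < x₀ * Real.exp u := by positivity
  rw [← mul_assoc, ← ENNReal.ofReal_mul (abs_nonneg _), abs_of_pos hpos, logDensity,
    indicator_of_mem (mem_Ioi.2 hpos), mul_div_cancel_left₀ _ hx₀.ne', Real.log_exp,
    mul_div_cancel₀ _ hpos.ne']

lemma isNonnegDensity_logDensity {x₀ : ℝ} (hx₀ : 0 < x₀) {ρ : ℝ → ℝ} (hρ : Measurable ρ)
    (h0 : ∀ u, 0 ≤ ρ u) (h1 : ∫⁻ u, ENNReal.ofReal (ρ u) = 1) :
    IsNonnegDensity (logDensity x₀ ρ) where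
  measurable := measurable_logDensity hρ
  nonneg x := indicator_nonneg (fun x hx => div_nonneg (h0 _) (le_of_lt hx)) x
  support x hx := indicator_of_notMem (by simp [hx.le]) _
  lintegral_eq_one := by
    have := lintegral_densityMeasure_logDensity hx₀ hρ (F := 1) measurable_one
    simp only [Pi.one_apply, mul_one, h1, lintegral_one, densityMeasure,
      withDensity_apply _ MeasurableSet.univ, setLIntegral_univ] at this
    exact this

/-- The law of `log η` when `η` has density `g`. -/
noncomputable def logLaw (g : ℝ → ℝ) : Measure ℝ := (densityMeasure g).map Real.log

lemma isProbabilityMeasure_logLaw {g : ℝ → ℝ} (hg : IsNonnegDensity g) :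
    IsProbabilityMeasure (logLaw g) := by
  have := hg.isProbabilityMeasure
  exact Measure.isProbabilityMeasure_map Real.measurable_log.aemeasurable

lemma IsNonnegDensity.ae_pos {g : ℝ → ℝ} (hg : IsNonnegDensity g) :
    ∀ᵐ y ∂densityMeasure g, 0 < y := by
  rw [densityMeasure, ae_withDensity_iff hg.measurable.ennreal_ofReal]
  filter_upwards [Measure.ae_ne volume (0 : ℝ)] with y hy0 hy
  by_contra! hle
  exact hy (by rw [hg.support y (lt_of_le_of_ne hle hy0), ENNReal.ofReal_zero])

/-- Almost surely `η > 0`, so `Y = x₀ * exp (U + log η)` with `U` of density `ρ`. Hence `log (Y /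
x₀)` has as density the convolution of `ρ` with `logLaw g`. -/
lemma lintegral_productLaw_logDensity {g : ℝ → ℝ} (hg : IsNonnegDensity g) {x₀ : ℝ} (hx₀ : 0 < x₀)
    {ρ : ℝ → ℝ} (hρ : Measurable ρ) (hf : IsNonnegDensity (logDensity x₀ ρ)) {F : ℝ → ℝ≥0∞}
    (hF : Measurable F) :
    ∫⁻ y, F y ∂productLaw g (logDensity x₀ ρ) =
      ∫⁻ w, (∫⁻ v, ENNReal.ofReal (ρ (w - v)) ∂logLaw g) * F (x₀ * Real.exp w) := by
  have := hg.isProbabilityMeasure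
  have := hf.isProbabilityMeasure
  have := isProbabilityMeasure_logLaw hg
  calc ∫⁻ y, F y ∂productLaw g (logDensity x₀ ρ)
      = ∫⁻ y, (∫⁻ x, F (x * y) ∂densityMeasure (logDensity x₀ ρ)) ∂densityMeasure g := by
        rw [productLaw, lintegral_map hF (by fun_prop), lintegral_prod_symm _ (by fun_prop)]
    _ = ∫⁻ y, (∫⁻ u, ENNReal.ofReal (ρ u) * F (x₀ * Real.exp (u + Real.log y)))
          ∂densityMeasure g := by
        refine lintegral_congr_ae ?_
        filter_upwards [hg.ae_pos] with y hy
        rw [lintegral_densityMeasure_logDensity hx₀ hρ (F := fun x => F (x * y)) (by fun_prop)]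
        simp only [Real.exp_add, Real.exp_log hy, mul_assoc]
    _ = ∫⁻ v, (∫⁻ u, ENNReal.ofReal (ρ u) * F (x₀ * Real.exp (u + v))) ∂logLaw g := by
        rw [logLaw, lintegral_map (f := fun v : ℝ => ∫⁻ u, ENNReal.ofReal (ρ u) *
          F (x₀ * Real.exp (u + v))) (Measurable.lintegral_prod_right' (f := fun p : ℝ × ℝ =>
            ENNReal.ofReal (ρ p.2) * F (x₀ * Real.exp (p.2 + p.1))) (by fun_prop))
          Real.measurable_log]
    _ = ∫⁻ v, (∫⁻ w, ENNReal.ofReal (ρ (w - v)) * F (x₀ * Real.exp w)) ∂logLaw g := by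
        congr 1 with v
        rw [← lintegral_sub_right_eq_self _ v]
        simp only [sub_add_cancel]
    _ = ∫⁻ w, (∫⁻ v, ENNReal.ofReal (ρ (w - v)) * F (x₀ * Real.exp w) ∂logLaw g) :=
        lintegral_lintegral_swap (by fun_prop)
    _ = _ := by
        congr 1 with w
        rw [lintegral_mul_const _ (by fun_prop)]

lemma integrable_integral_comp_sub {μ : Measure ℝ} [IsProbabilityMeasure μ] {F : ℝ → ℝ}
    (hF : Integrable F) :
    Integrable (fun w => ∫ v, F (w - v) ∂μ) ∧ ∫ w, ∫ v, F (w - v) ∂μ = ∫ u, F u := by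
  have hi : Integrable (Function.uncurry fun w v : ℝ => F (w - v)) (volume.prod μ) := by
    simpa [Function.uncurry_def] using
      integrable_prod_mul_comp_sub hF (integrable_const (1 : ℝ) (μ := μ))
  refine ⟨hi.integral_prod_left, ?_⟩
  rw [integral_integral_swap hi]
  simp [integral_sub_right_eq_self]

/-- Comparison of the laws of the observations under two densities, through the `χ²` distance in
the logarithmic coordinate. -/
lemma sqDominated_productLaw_logDensity {g : ℝ → ℝ} (hg : IsNonnegDensity g) {x₀ : ℝ}
    (hx₀ : 0 < x₀) {ρ ψ : ℝ → ℝ} (hρ : Measurable ρ) (hψ : Measurable ψ) (hρ0 : ∀ u, 0 ≤ ρ u)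
    (hρψ0 : ∀ u, 0 ≤ ρ u + ψ u) (hρi : Integrable ρ) (hψi : Integrable ψ) {R : ℝ}
    (hρR : ∀ u, |ρ u| ≤ R) (hψR : ∀ u, |ψ u| ≤ R)
    (hρ1 : ∫ u, ρ u = 1) (hψ1 : ∫ u, ψ u = 0) {c κ : ℝ} (hc : 0 < c) (hκ : 0 ≤ κ)
    (hlow : ∀ w, c * (1 + w ^ 2)⁻¹ ≤ ∫ v, ρ (w - v) ∂logLaw g)
    (hqi : Integrable fun w => (1 + w ^ 2) * (∫ v, ψ (w - v) ∂logLaw g) ^ 2)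
    (hq : ∫ w, (1 + w ^ 2) * (∫ v, ψ (w - v) ∂logLaw g) ^ 2 ≤ c * κ) :
    IsNonnegDensity (logDensity x₀ ρ) ∧ IsNonnegDensity (logDensity x₀ fun u => ρ u + ψ u) ∧
      SqDominated (1 + ENNReal.ofReal κ) (productLaw g (logDensity x₀ fun u => ρ u + ψ u))
        (productLaw g (logDensity x₀ ρ)) := by
  have hsm : Measurable fun u => ρ u + ψ u := hρ.add hψ
  have hsi : Integrable fun u => ρ u + ψ u := hρi.add hψi
  have hD0 : IsNonnegDensity (logDensity x₀ ρ) := by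
    refine isNonnegDensity_logDensity hx₀ hρ hρ0 ?_
    rw [← ofReal_integral_eq_lintegral_ofReal hρi (ae_of_all _ hρ0), hρ1, ENNReal.ofReal_one]
  have hD1 : IsNonnegDensity (logDensity x₀ fun u => ρ u + ψ u) := by
    refine isNonnegDensity_logDensity hx₀ hsm hρψ0 ?_
    rw [← ofReal_integral_eq_lintegral_ofReal hsi (ae_of_all _ hρψ0),
      integral_add hρi hψi, hρ1, hψ1, add_zero, ENNReal.ofReal_one]
  refine ⟨hD0, hD1, ?_⟩
  have hprob := isProbabilityMeasure_logLaw hg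
  set μ := logLaw g with hμ
  set P : ℝ → ℝ := fun w => ∫ v, ρ (w - v) ∂μ with hP
  set q : ℝ → ℝ := fun w => ∫ v, ψ (w - v) ∂μ with hq'
  have hρb : ∀ w, Integrable (fun v => ρ (w - v)) μ := fun w =>
    Integrable.of_bound (by fun_prop : Measurable fun v => ρ (w - v)).aestronglyMeasurable R
      (ae_of_all _ fun v => hρR _)
  have hψb : ∀ w, Integrable (fun v => ψ (w - v)) μ := fun w =>
    Integrable.of_bound (by fun_prop : Measurable fun v => ψ (w - v)).aestronglyMeasurable R
      (ae_of_all _ fun v => hψR _)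
  have hPeq : ∀ w, ∫⁻ v, ENNReal.ofReal (ρ (w - v)) ∂μ = ENNReal.ofReal (P w) := fun w =>
    (ofReal_integral_eq_lintegral_ofReal (hρb w) (ae_of_all _ fun _ => hρ0 _)).symm
  have hPqeq : ∀ w, ∫⁻ v, ENNReal.ofReal (ρ (w - v) + ψ (w - v)) ∂μ =
      ENNReal.ofReal (P w + q w) := fun w => by
    have hi : Integrable (fun v => ρ (w - v) + ψ (w - v)) μ := (hρb w).add (hψb w)
    rw [← ofReal_integral_eq_lintegral_ofReal hi
      (ae_of_all _ fun _ => hρψ0 _), integral_add (hρb w) (hψb w)]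
  have hPpos : ∀ w, 0 < P w := fun w => lt_of_lt_of_le (by positivity) (hlow w)
  obtain ⟨hPi, hP1⟩ := integrable_integral_comp_sub (μ := μ) hρi
  obtain ⟨hqi1, hq1⟩ := integrable_integral_comp_sub (μ := μ) hψi
  change Integrable P at hPi
  change Integrable q at hqi1
  change ∫ w, P w = _ at hP1
  change ∫ w, q w = _ at hq1
  have hPqi : Integrable fun w => P w + 2 * q w := hPi.add (hqi1.const_mul 2)
  have hPm : Measurable P :=
    (StronglyMeasurable.integral_prod_right' (f := fun p : ℝ × ℝ => ρ (p.1 - p.2))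
      (by fun_prop : Measurable fun p : ℝ × ℝ => ρ (p.1 - p.2)).stronglyMeasurable).measurable
  have hqm : Measurable q :=
    (StronglyMeasurable.integral_prod_right' (f := fun p : ℝ × ℝ => ψ (p.1 - p.2))
      (by fun_prop : Measurable fun p : ℝ × ℝ => ψ (p.1 - p.2)).stronglyMeasurable).measurable
  -- This is `1 + χ²`: expanding `(P + q) ^ 2 / P` gives `P + 2 * q + q ^ 2 / P`, where `P`
  -- integrates to `1`, `q` to `0`, and the lower bound on `P` turns the last term into the weighted
  -- square.
  have hchi : ∫⁻ w, ENNReal.ofReal (P w) * (ENNReal.ofReal ((P w + q w) / P w)) ^ 2 ≤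
      1 + ENNReal.ofReal κ := by
    have hpt : ∀ w, P w * ((P w + q w) / P w) ^ 2 ≤
        P w + 2 * q w + c⁻¹ * ((1 + w ^ 2) * q w ^ 2) := fun w => by
      have h1 := hPpos w
      have h2 : (P w)⁻¹ ≤ c⁻¹ * (1 + w ^ 2) := by
        have := inv_anti₀ (by positivity) (hlow w)
        rwa [mul_inv, inv_inv] at this
      calc P w * ((P w + q w) / P w) ^ 2 = P w + 2 * q w + (P w)⁻¹ * q w ^ 2 := by
            field_simp; ring
        _ ≤ P w + 2 * q w + (c⁻¹ * (1 + w ^ 2)) * q w ^ 2 := by gcongr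
        _ = _ := by ring
    have hint : Integrable fun w => P w + 2 * q w + c⁻¹ * ((1 + w ^ 2) * q w ^ 2) :=
      hPqi.add (hqi.const_mul _)
    calc _ ≤ ∫⁻ w, ENNReal.ofReal (P w + 2 * q w + c⁻¹ * ((1 + w ^ 2) * q w ^ 2)) := by
          gcongr with w
          rw [← ENNReal.ofReal_pow, ← ENNReal.ofReal_mul (hPpos w).le]
          · exact ENNReal.ofReal_le_ofReal (hpt w)
          · refine div_nonneg ?_ (hPpos w).le
            rw [← integral_add (hρb w) (hψb w)]
            exact integral_nonneg fun _ => hρψ0 _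
      _ = ENNReal.ofReal (∫ w, (P w + 2 * q w + c⁻¹ * ((1 + w ^ 2) * q w ^ 2))) :=
          (ofReal_integral_eq_lintegral_ofReal hint (ae_of_all _ fun w =>
            le_trans (mul_nonneg (hPpos w).le (sq_nonneg _)) (hpt w))).symm
      _ ≤ ENNReal.ofReal (1 + κ) := by
          apply ENNReal.ofReal_le_ofReal
          rw [integral_add hPqi (hqi.const_mul _),
            integral_add hPi (hqi1.const_mul 2), integral_const_mul, integral_const_mul, hP1, hq1,
            hρ1, hψ1]
          have := mul_le_mul_of_nonneg_left hq (inv_pos.2 hc).le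
          rw [← mul_assoc, inv_mul_cancel₀ hc.ne', one_mul] at this
          linarith
      _ = _ := by rw [ENNReal.ofReal_add zero_le_one hκ, ENNReal.ofReal_one]
  intro F hF
  rw [lintegral_productLaw_logDensity hg hx₀ hsm hD1 hF,
    lintegral_productLaw_logDensity hg hx₀ hρ hD0 (hF.pow_const 2)]
  simp only [← hμ, hPeq, hPqeq]
  have hFm : Measurable fun w => F (x₀ * Real.exp w) := by fun_prop
  have hrm : Measurable fun w => ENNReal.ofReal ((P w + q w) / P w) := by fun_prop
  have hPm' : Measurable fun w => ENNReal.ofReal (P w) := by fun_prop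
  have hrF : Measurable fun w => ENNReal.ofReal ((P w + q w) / P w) * F (x₀ * Real.exp w) :=
    hrm.mul hFm
  have hr2 : Measurable fun w => ENNReal.ofReal ((P w + q w) / P w) ^ 2 := hrm.pow_const 2
  have hF2 : Measurable fun w => F (x₀ * Real.exp w) ^ 2 := hFm.pow_const 2
  -- Cauchy–Schwarz under the base law, with the likelihood ratio as one factor.
  have hCS := ENNReal.sq_lintegral_mul_le (volume.withDensity fun w => ENNReal.ofReal (P w))
    hrm.aemeasurable hFm.aemeasurable
  rw [lintegral_withDensity_eq_lintegral_mul _ hPm' hrF,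
    lintegral_withDensity_eq_lintegral_mul _ hPm' hr2,
    lintegral_withDensity_eq_lintegral_mul _ hPm' hF2] at hCS
  simp only [Pi.mul_apply] at hCS
  have heq : ∀ w, ENNReal.ofReal (P w) * (ENNReal.ofReal ((P w + q w) / P w) *
      F (x₀ * Real.exp w)) = ENNReal.ofReal (P w + q w) * F (x₀ * Real.exp w) := fun w => by
    rw [← mul_assoc, ← ENNReal.ofReal_mul (hPpos w).le, mul_div_cancel₀ _ (hPpos w).ne']
  simp only [heq] at hCS
  exact hCS.trans (mul_le_mul_left hchi _)

/-! ### The Mellin transform as a characteristic function -/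

section Mellin

open ProbabilityTheory

lemma complexMGF_log_densityMeasure {g : ℝ → ℝ} (hg : IsNonnegDensity g) (z : ℂ) :
    complexMGF Real.log (densityMeasure g) z = mellinTransform g (z + 1) := by
  rw [complexMGF, densityMeasure, integral_withDensity_eq_integral_toReal_smul
    hg.measurable.ennreal_ofReal (by simp), mellinTransform, mellin,
    ← integral_indicator measurableSet_Ioi]
  refine integral_congr_ae ?_
  filter_upwards [Measure.ae_ne volume (0 : ℝ)] with x hx0
  by_cases hx : 0 < x
  · rw [indicator_of_mem (mem_Ioi.2 hx), ENNReal.toReal_ofReal (hg.nonneg x), add_sub_cancel_right,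
      Complex.cpow_def_of_ne_zero (by exact_mod_cast hx0), Complex.ofReal_log hx.le, smul_eq_mul,
      Complex.real_smul, mul_comm z, mul_comm]
  · rw [indicator_of_notMem (by simpa using hx),
      hg.support x (lt_of_le_of_ne (not_lt.1 hx) hx0)]
    simp

/-- Absolute convergence at `Re z = 1 + t` is the existence of the exponential moment of order `t`
of `log η`. This yields the first moment and the differentiability of the Mellin transform on the
line. -/
lemma zero_mem_interior_integrableExpSet_log {g : ℝ → ℝ} (hg : IsNonnegDensity g)
    (hs : MellinStripAround g 1) :
    (0 : ℝ) ∈ interior (integrableExpSet Real.log (densityMeasure g)) := by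
  obtain ⟨a, b, ha, hb, hconv⟩ := hs
  refine mem_interior.2 ⟨Ioo (a - 1) (b - 1), fun t ht => ?_, isOpen_Ioo, by simp [ha, hb]⟩
  have h1 := hconv ((t + 1 : ℝ) : ℂ) (by simpa using by linarith [ht.1])
    (by simpa using by linarith [ht.2])
  have h2 := (integrable_indicator_iff measurableSet_Ioi).2 h1
  rw [integrableExpSet, mem_ofPred, densityMeasure, integrable_withDensity_iff
    hg.measurable.ennreal_ofReal (by simp)]
  refine h2.norm.congr ?_
  filter_upwards [Measure.ae_ne volume (0 : ℝ)] with x hx0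
  by_cases hx : 0 < x
  · rw [indicator_of_mem (mem_Ioi.2 hx), ENNReal.toReal_ofReal (hg.nonneg x), norm_smul,
      Complex.norm_cpow_eq_rpow_re_of_pos hx, Complex.norm_real, Real.norm_of_nonneg (hg.nonneg x),
      Real.rpow_def_of_pos hx]
    simp [mul_comm]
  · rw [indicator_of_notMem (by simpa using hx),
      hg.support x (lt_of_le_of_ne (not_lt.1 hx) hx0)]
    simp

lemma charFun_logLaw {g : ℝ → ℝ} (hg : IsNonnegDensity g) (t : ℝ) :
    charFun (logLaw g) t = mellinTransform g ((1 : ℝ) + t * Complex.I) := by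
  rw [logLaw, ← complexMGF_mul_I Real.measurable_log.aemeasurable,
    complexMGF_log_densityMeasure hg, add_comm, Complex.ofReal_one]

lemma norm_deriv_charFun_logLaw {g : ℝ → ℝ} (hg : IsNonnegDensity g)
    (hs : MellinStripAround g 1) (t : ℝ) :
    ‖deriv (charFun (logLaw g)) t‖ = ‖deriv (mellinTransform g) ((1 : ℝ) + t * Complex.I)‖ := by
  have hmem : (t * Complex.I : ℂ).re ∈ interior (integrableExpSet Real.log (densityMeasure g)) := by
    simpa using zero_mem_interior_integrableExpSet_log hg hs
  have h1 := hasDerivAt_complexMGF hmem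
  set D := ∫ x, (fun ω => (Real.log ω : ℂ) * Complex.exp (t * Complex.I * Real.log ω)) x
    ∂densityMeasure g
  have h2 : HasDerivAt (charFun (logLaw g)) (D * Complex.I) t := by
    have h3 : HasDerivAt (fun t : ℝ => (t : ℂ) * Complex.I) Complex.I t := by
      simpa using (hasDerivAt_id t).ofReal_comp.mul_const Complex.I
    have h4 := h1.comp t h3
    refine h4.congr_of_eventuallyEq (Eventually.of_forall fun s => ?_)
    rw [logLaw, ← complexMGF_mul_I Real.measurable_log.aemeasurable]
    rfl
  have h5 : HasDerivAt (mellinTransform g) D ((1 : ℝ) + t * Complex.I) := by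
    have h6 : HasDerivAt (fun s : ℂ => s - 1) 1 ((1 : ℝ) + t * Complex.I) :=
      (hasDerivAt_id _).sub_const 1
    have h7 : HasDerivAt (complexMGF Real.log (densityMeasure g)) D
        (((1 : ℝ) + t * Complex.I : ℂ) - 1) := by
      rwa [Complex.ofReal_one, add_sub_cancel_left]
    refine ((HasDerivAt.comp (h := fun s : ℂ => s - 1) _ h7 h6).congr_deriv (mul_one D)).congr_of_eventuallyEq
      (Eventually.of_forall fun s => ?_)
    rw [Function.comp_apply, complexMGF_log_densityMeasure hg, sub_add_cancel]
  rw [h2.deriv, h5.deriv, norm_mul, Complex.norm_I, mul_one]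

lemma charFunDecay_logLaw {g : ℝ → ℝ} {γ ω₀ c₀ B₁ B₂ B : ℝ} (hg : IsNonnegDensity g)
    (hs : MellinStripAround g 1) (h1 : MellinPolynomialDecay g 1 γ ω₀ c₀ B₁ B₂)
    (h2 : MellinDerivDecay g 1 γ ω₀ B) : CharFunDecay (logLaw g) γ ω₀ B₂ B where
  integrable_id := by
    have h := memLp_of_mem_interior_integrableExpSet
      (zero_mem_interior_integrableExpSet_log hg hs) 1
    rw [logLaw, integrable_map_measure (by fun_prop) Real.measurable_log.aemeasurable]
    exact memLp_one_iff_integrable.1 (by simpa using h)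
  upper t ht := by
    rw [charFun_logLaw hg]
    exact h1.upper t ht
  deriv_upper t ht := by
    rw [norm_deriv_charFun_logLaw hg hs]
    exact h2 t ht

end Mellin

/-! ### The base density and its tails -/

/-- The function equal to `exp` on `[-R, R]` and to `u ↦ 1 / (1 + u ^ 2)` elsewhere. -/
noncomputable def expCauchy (R u : ℝ) : ℝ :=
  if |u| ≤ R then Real.exp u else (1 + u ^ 2)⁻¹

lemma measurable_expCauchy (R : ℝ) : Measurable (expCauchy R) :=
  Measurable.ite (measurableSet_le (by fun_prop) (by fun_prop)) (by fun_prop) (by fun_prop)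

lemma le_expCauchy {R : ℝ} (hR : 0 ≤ R) (u : ℝ) :
    Real.exp (-R) * (1 + u ^ 2)⁻¹ ≤ expCauchy R u := by
  have h1 : (1 + u ^ 2)⁻¹ ≤ 1 := inv_le_one_of_one_le₀ (by nlinarith [sq_nonneg u])
  have h0 : 0 ≤ (1 + u ^ 2)⁻¹ := by positivity
  unfold expCauchy
  split_ifs with hu
  · calc Real.exp (-R) * (1 + u ^ 2)⁻¹ ≤ Real.exp (-R) * 1 := by gcongr
      _ ≤ Real.exp u := by rw [mul_one]; gcongr; exact (abs_le.1 hu).1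
  · exact mul_le_of_le_one_left h0 (Real.exp_le_one_iff.2 (by linarith))

lemma expCauchy_nonneg {R : ℝ} (hR : 0 ≤ R) (u : ℝ) : 0 ≤ expCauchy R u :=
  le_trans (by positivity) (le_expCauchy hR u)

lemma expCauchy_le {R : ℝ} (hR : 0 ≤ R) (u : ℝ) : expCauchy R u ≤ Real.exp R := by
  unfold expCauchy
  split_ifs with hu
  · gcongr; exact (abs_le.1 hu).2
  · exact (inv_le_one_of_one_le₀ (by nlinarith [sq_nonneg u])).trans (Real.one_le_exp hR)

lemma integrable_expCauchy {R : ℝ} (hR : 0 ≤ R) : Integrable (expCauchy R) := by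
  have h1 : Integrable ((Icc (-R) R).indicator fun _ : ℝ => Real.exp R) :=
    (integrable_indicator_iff measurableSet_Icc).2 (by simp)
  refine (h1.add integrable_inv_one_add_sq).mono' (measurable_expCauchy R).aestronglyMeasurable
    (ae_of_all _ fun u => ?_)
  rw [Real.norm_of_nonneg (expCauchy_nonneg hR u), Pi.add_apply]
  by_cases hu : |u| ≤ R
  · rw [indicator_of_mem (show u ∈ Icc (-R) R from abs_le.1 hu)]
    exact (expCauchy_le hR u).trans (le_add_of_nonneg_right (by positivity))
  · rw [indicator_of_notMem (fun h : u ∈ Icc (-R) R => hu (abs_le.2 h)), zero_add, expCauchy,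
      if_neg hu]

lemma integral_expCauchy_pos {R : ℝ} (hR : 0 ≤ R) : 0 < ∫ u, expCauchy R u := by
  calc 0 < Real.exp (-R) * π := by positivity
    _ = ∫ u : ℝ, Real.exp (-R) * (1 + u ^ 2)⁻¹ := by
        rw [integral_const_mul, integral_univ_inv_one_add_sq]
    _ ≤ ∫ u, expCauchy R u := integral_mono (integrable_inv_one_add_sq.const_mul _)
        (integrable_expCauchy hR) (le_expCauchy hR)

/-- A Cauchy-type lower bound is preserved by smoothing with a law that charges `[-M, M]`. -/
lemma le_integral_comp_sub_of_cauchy_le {μ : Measure ℝ} [IsProbabilityMeasure μ] {M c a : ℝ}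
    (ha : 0 ≤ a) (hc : c ≤ μ.real (Icc (-M) M)) {ρ : ℝ → ℝ}
    (hρ : ∀ u, a * (1 + u ^ 2)⁻¹ ≤ ρ u) (w : ℝ) (hi : Integrable (fun v => ρ (w - v)) μ) :
    a * c / (2 * (1 + M ^ 2)) * (1 + w ^ 2)⁻¹ ≤ ∫ v, ρ (w - v) ∂μ := by
  have h1 : ∀ v, (Icc (-M) M).indicator (fun _ => a * (2 * (1 + M ^ 2) * (1 + w ^ 2))⁻¹) v ≤
      ρ (w - v) := fun v => by
    by_cases hv : v ∈ Icc (-M) M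
    · rw [indicator_of_mem hv]
      refine le_trans ?_ (hρ _)
      gcongr
      -- What remains is `1 + (w - v) ^ 2 ≤ 2 * (1 + M ^ 2) * (1 + w ^ 2)`, from `(w - v) ^ 2 ≤ 2 *
      -- w ^ 2 + 2 * v ^ 2`.
      have : v ^ 2 ≤ M ^ 2 := sq_le_sq' hv.1 hv.2
      nlinarith [sq_nonneg (w + v), mul_nonneg (sq_nonneg M) (sq_nonneg w)]
    · rw [indicator_of_notMem hv]
      exact le_trans (by positivity) (hρ _)
  calc a * c / (2 * (1 + M ^ 2)) * (1 + w ^ 2)⁻¹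
      = c * (a * (2 * (1 + M ^ 2) * (1 + w ^ 2))⁻¹) := by
        rw [mul_inv]; ring
    _ ≤ μ.real (Icc (-M) M) * (a * (2 * (1 + M ^ 2) * (1 + w ^ 2))⁻¹) := by gcongr
    _ = ∫ v, (Icc (-M) M).indicator (fun _ => a * (2 * (1 + M ^ 2) * (1 + w ^ 2))⁻¹) v ∂μ := by
        rw [integral_indicator_const _ measurableSet_Icc, smul_eq_mul]
    _ ≤ _ := integral_mono ((integrable_const _).indicator measurableSet_Icc) hi h1

end LogCoordinate

/-! ### The two hypotheses and the choice of bandwidth -/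

/-- Lower bound for the minimax risk at bandwidth `h` and sample size `n`, when the two are
balanced. -/
lemma exists_ofReal_le_minimaxRisk {β r γ ω₀ B₁ B₂ B : ℝ} (hβ : 0 < β) (hr : 1 < r) (hγ : 0 < γ)
    (hω₀ : 0 < ω₀) (hB₁ : 0 < B₁) (hB₂ : 0 ≤ B₂) (hB : 0 ≤ B) :
    ∃ s : ℝ, 0 < s ∧ ∀ (x₀ A c₀ : ℝ) (g : ℝ → ℝ), 0 < x₀ → 0 < A → IsNonnegDensity g →
      MellinStripAround g 1 → MellinPolynomialDecay g 1 γ ω₀ c₀ B₁ B₂ →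
      MellinDerivDecay g 1 γ ω₀ B → ∃ δ : ℝ, 0 < δ ∧ ∀ (n : ℕ) (h : ℝ), n ≠ 0 → 0 < h → h ≤ δ →
        n * (A * x₀ ^ (β + 1)) ^ 2 * h ^ (2 * β + 2 * γ + 1) = 1 →
        ENNReal.ofReal (s * (A * x₀ ^ β * h ^ β)) ≤
          3 * minimaxRisk g x₀ n {f | LocalHolderDensity x₀ r A β f} := by
  obtain ⟨k, hks, hkc, hksupp, hk0, C, hC0, hC⟩ := exists_bump_fourier_bound hγ
  obtain ⟨CH, hCH0, hCH⟩ := exists_localHolderDensity_of_logBump hβ hr hks hkc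
  obtain ⟨D, hD0, hD⟩ := exists_weighted_integral_sq_le hγ hω₀ hB₂ hB hks.continuous hkc hC0 hC
  obtain ⟨M, c, hc0, hc⟩ := exists_measureReal_Icc_ge (B₂ := B₂) hγ hω₀ hB₁ hB
  obtain ⟨Ck, hCk⟩ := hks.continuous.bounded_above_of_compact_support hkc
  have hCk0 : 0 ≤ Ck := (norm_nonneg _).trans (hCk 0)
  -- In the logarithmic coordinate the Hölder window is `[-R, R]`. There `ρ` is proportional to `exp
  -- u`, so that the density in `x` is constant.
  set R := Real.log r with hR
  have hR0 : 0 < R := Real.log_pos hr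
  set Z := ∫ u, expCauchy R u with hZ
  have hZ0 : 0 < Z := integral_expCauchy_pos hR0.le
  set ρ : ℝ → ℝ := fun u => Z⁻¹ * expCauchy R u with hρ
  have hρm : Measurable ρ := (measurable_expCauchy R).const_mul _
  have hρi : Integrable ρ := (integrable_expCauchy hR0.le).const_mul _
  have hρ1 : ∫ u, ρ u = 1 := by
    rw [hρ, integral_const_mul, inv_mul_cancel₀ hZ0.ne']
  set a₀ := Z⁻¹ * Real.exp (-R) with ha₀
  have ha₀0 : 0 < a₀ := by positivity
  have hρlow : ∀ u, a₀ * (1 + u ^ 2)⁻¹ ≤ ρ u := fun u => by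
    rw [ha₀, mul_assoc]
    exact mul_le_mul_of_nonneg_left (le_expCauchy hR0.le u) (by positivity)
  have hρ0 : ∀ u, 0 ≤ ρ u := fun u => le_trans (by positivity) (hρlow u)
  have hρR : ∀ u, ρ u ≤ Z⁻¹ * Real.exp R := fun u =>
    mul_le_mul_of_nonneg_left (expCauchy_le hR0.le u) (by positivity)
  have hρR' : ∀ u, |ρ u| ≤ Z⁻¹ * Real.exp R := fun u => by
    rw [abs_of_nonneg (hρ0 u)]
    exact hρR u
  have hρexp : ∀ u, |u| ≤ R → ρ u = Z⁻¹ * Real.exp u := fun u hu => by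
    simp only [hρ, expCauchy, if_pos hu]
  set cl := a₀ * c / (2 * (1 + M ^ 2)) with hcl
  have hcl0 : 0 < cl := by positivity
  -- The transform of `k` vanishes at `0`, so the perturbation has no mass.
  have hk_int : ∫ u, k u = 0 := by
    have h1 := (hC 0).1
    rw [abs_zero, Real.zero_rpow hγ.ne', zero_mul, mul_zero, Real.fourier_real_eq] at h1
    have h2 : ∫ u : ℝ, (k u : ℂ) = 0 := by
      rw [← norm_le_zero_iff]
      simpa using h1
    rw [integral_complex_ofReal] at h2
    exact_mod_cast h2
  have hki : Integrable k := hks.continuous.integrable_of_hasCompactSupport hkc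
  -- The first bound keeps the bump in the Hölder class, the second keeps the `χ²` distance per
  -- observation below `1 / n`. Neither depends on `g`, `x₀` or `A`.
  set s := min CH⁻¹ (Real.sqrt (cl / D)) with hs
  have hs0 : 0 < s := by positivity
  have hsCH : s * CH ≤ 1 := by
    calc s * CH ≤ CH⁻¹ * CH := by gcongr; exact min_le_left _ _
      _ = 1 := inv_mul_cancel₀ hCH0.ne'
  have hsD : s ^ 2 * D ≤ cl := by
    calc s ^ 2 * D ≤ (Real.sqrt (cl / D)) ^ 2 * D := by gcongr; exact min_le_right _ _
      _ = cl := by rw [Real.sq_sqrt (by positivity), div_mul_cancel₀ _ hD0.ne']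
  refine ⟨s, hs0, fun x₀ A c₀ g hx₀ hA hg hstrip hdec hder => ?_⟩
  have hprob := isProbabilityMeasure_logLaw hg
  have hcf := charFunDecay_logLaw hg hstrip hdec hder
  obtain ⟨h₀, hh₀, hquad⟩ := hD (logLaw g) hprob hcf
  have htight : c ≤ (logLaw g).real (Icc (-M) M) := hc (logLaw g) hprob hcf fun t ht => by
    rw [charFun_logLaw hg]
    exact hdec.lower t ht
  set E := s * (A * x₀ ^ (β + 1)) * (Ck + 1) with hE
  have hE0 : 0 < E := by positivity
  -- In turn: `h ≤ 1` and `x₀ * h ≤ 1` for the Hölder estimate, `h₀` for the Plancherel estimate,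
  -- `R` to keep the bump inside the window, and the last entry to keep the perturbed density
  -- nonnegative.
  refine ⟨min (min 1 x₀⁻¹) (min (min h₀ R) ((a₀ * (1 + R ^ 2)⁻¹ / E) ^ (β⁻¹))), by positivity,
    fun n h hn hh hhle hbal => ?_⟩
  simp only [le_min_iff] at hhle
  obtain ⟨⟨hh1, hhx⟩, ⟨hhh₀, hhR⟩, hhE⟩ := hhle
  have hn0 : (0 : ℝ) < n := by exact_mod_cast Nat.pos_of_ne_zero hn
  have hxh : x₀ * h ≤ 1 := by
    calc x₀ * h ≤ x₀ * x₀⁻¹ := by gcongr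
      _ = 1 := mul_inv_cancel₀ hx₀.ne'
  set a := s * (A * x₀ ^ (β + 1)) * h ^ β with ha
  have ha0 : 0 < a := by positivity
  have hak : a * Ck ≤ a₀ * (1 + R ^ 2)⁻¹ := by
    have h1 : h ^ β ≤ a₀ * (1 + R ^ 2)⁻¹ / E := by
      calc h ^ β ≤ ((a₀ * (1 + R ^ 2)⁻¹ / E) ^ (β⁻¹)) ^ β := by gcongr
        _ = _ := by rw [← Real.rpow_mul (by positivity), inv_mul_cancel₀ hβ.ne', Real.rpow_one]
    calc a * Ck ≤ a * (Ck + 1) := by gcongr; linarith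
      _ = E * h ^ β := by rw [ha, hE]; ring
      _ ≤ E * (a₀ * (1 + R ^ 2)⁻¹ / E) := by gcongr
      _ = _ := mul_div_cancel₀ _ hE0.ne'
  set ψ : ℝ → ℝ := fun u => a * k (u / h) with hψ
  have hψm : Measurable ψ := by
    have := hks.continuous.measurable
    fun_prop
  have hψk : ∀ u, |ψ u| ≤ a * Ck := fun u => by
    rw [hψ, abs_mul, abs_of_pos ha0]
    exact mul_le_mul_of_nonneg_left (hCk _) ha0.le
  have hψsupp : ∀ u, R < |u| → ψ u = 0 := fun u hu => by
    simp only [hψ]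
    rw [hksupp, mul_zero]
    rw [abs_div, abs_of_pos hh, one_lt_div hh]
    linarith
  have hρψ0 : ∀ u, 0 ≤ ρ u + ψ u := fun u => by
    rcases lt_or_ge R |u| with hu | hu
    · rw [hψsupp u hu, add_zero]
      exact hρ0 u
    · have h1 : a₀ * (1 + R ^ 2)⁻¹ ≤ a₀ * (1 + u ^ 2)⁻¹ := by
        refine mul_le_mul_of_nonneg_left (inv_anti₀ (by positivity) ?_) ha₀0.le
        linarith [sq_le_sq' (abs_le.1 hu).1 (abs_le.1 hu).2]
      linarith [hρlow u, (abs_le.1 (hψk u)).1]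
  have hψi : Integrable ψ := (hki.comp_div hh.ne').const_mul a
  have hψ1 : ∫ u, ψ u = 0 := by
    simp only [hψ]
    rw [integral_const_mul, Measure.integral_comp_div, hk_int, smul_zero, mul_zero]
  obtain ⟨hq1, hq2⟩ := hquad h hh hhh₀
  have hqe : ∀ w, (1 + w ^ 2) * (∫ v, ψ (w - v) ∂logLaw g) ^ 2 =
      a ^ 2 * ((1 + w ^ 2) * (∫ v, k ((w - v) / h) ∂logLaw g) ^ 2) := fun w => by
    simp only [hψ]
    rw [integral_const_mul]
    ring
  have hchi : a ^ 2 * (D * h ^ (2 * γ + 1)) ≤ cl * (n : ℝ)⁻¹ := by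
    have h1 : (A * x₀ ^ (β + 1)) ^ 2 * h ^ (2 * β + 2 * γ + 1) = (n : ℝ)⁻¹ := by
      rw [mul_assoc] at hbal
      exact eq_inv_of_mul_eq_one_right hbal
    have h2 : h ^ (2 * β + 2 * γ + 1) = (h ^ β) ^ 2 * h ^ (2 * γ + 1) := by
      rw [show 2 * β + 2 * γ + 1 = β + β + (2 * γ + 1) by ring, Real.rpow_add hh, Real.rpow_add hh,
        sq]
    calc a ^ 2 * (D * h ^ (2 * γ + 1))
        = s ^ 2 * D * ((A * x₀ ^ (β + 1)) ^ 2 * h ^ (2 * β + 2 * γ + 1)) := by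
          rw [h2, ha]; ring
      _ ≤ cl * (n : ℝ)⁻¹ := by rw [h1]; gcongr
  obtain ⟨hf₀, hf₁, hdom⟩ := sqDominated_productLaw_logDensity hg hx₀ hρm hψm hρ0 hρψ0 hρi hψi
    (R := max (Z⁻¹ * Real.exp R) (a * Ck)) (fun u => (hρR' u).trans (le_max_left _ _))
    (fun u => (hψk u).trans (le_max_right _ _)) hρ1 hψ1 hcl0 (inv_nonneg.2 hn0.le)
    (fun w => le_integral_comp_sub_of_cauchy_le ha₀0.le htight hρlow w
      (Integrable.of_bound
        (by fun_prop : Measurable fun v => ρ (w - v)).aestronglyMeasurable _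
        (ae_of_all _ fun v => hρR' (w - v))))
    (by simp only [hqe]; exact hq1.const_mul _)
    (by
      simp only [hqe]
      rw [integral_const_mul]
      exact (mul_le_mul_of_nonneg_left hq2 (sq_nonneg a)).trans hchi)
  -- The parameter `b` handles both hypotheses at once: `b = 0` is the base density, `b = 1` the
  -- perturbed one.
  have hform : ∀ x ∈ Icc (r⁻¹ * x₀) (r * x₀), ∀ b : ℝ,
      logDensity x₀ (fun u => ρ u + b * (a * k (u / h))) x =
        Z⁻¹ / x₀ + b * (a / x₀) * logBump k 1 x₀ h x := fun x hx b => by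
    have hx0 : 0 < x := Icc_inv_mul_subset_Ioi hr hx₀ hx
    have hq0 : 0 < x / x₀ := by positivity
    have hlog : |Real.log (x / x₀)| ≤ R := by
      rw [abs_le]
      constructor
      · rw [hR, ← Real.log_inv]
        exact Real.log_le_log (by positivity) ((le_div_iff₀ hx₀).2 hx.1)
      · exact Real.log_le_log hq0 ((div_le_iff₀ hx₀).2 hx.2)
    rw [logDensity, indicator_of_mem (mem_Ioi.2 hx0), hρexp _ hlog, Real.exp_log hq0, logBump]
    field_simp
  have hmem : ∀ b : ℝ, 0 ≤ b → b ≤ 1 →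
      IsNonnegDensity (logDensity x₀ fun u => ρ u + b * (a * k (u / h))) →
      LocalHolderDensity x₀ r A β (logDensity x₀ fun u => ρ u + b * (a * k (u / h))) :=
    fun b hb0 hb1 hd => by
      refine hCH x₀ h A (b * (a / x₀)) (Z⁻¹ / x₀) _ hx₀ hh hh1 hxh (by positivity) ?_ hd
        fun x hx => hform x hx b
      have h1 : a / x₀ = s * (A * (x₀ * h) ^ β) := by
        rw [ha, Real.rpow_add_one hx₀.ne', Real.mul_rpow hx₀.le hh.le]
        field_simp
      calc b * (a / x₀) * CH ≤ 1 * (a / x₀) * CH := by gcongr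
        _ = s * CH * (A * (x₀ * h) ^ β) := by rw [h1]; ring
        _ ≤ 1 * (A * (x₀ * h) ^ β) := by gcongr
        _ = _ := one_mul _
  have h0eq : (fun u => ρ u + 0 * (a * k (u / h))) = ρ := by ext u; ring
  have h1eq : (fun u => ρ u + 1 * (a * k (u / h))) = fun u => ρ u + ψ u := by ext u; simp [hψ]
  have hm₀ := hmem 0 le_rfl zero_le_one
  have hm₁ := hmem 1 zero_le_one le_rfl
  rw [h0eq] at hm₀
  rw [h1eq] at hm₁
  have hκ : ENNReal.ofReal ((n : ℝ)⁻¹) = (n : ℝ≥0∞)⁻¹ := by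
    rw [ENNReal.ofReal_inv_of_pos hn0, ENNReal.ofReal_natCast]
  rw [hκ] at hdom
  have hx₀mem : x₀ ∈ Icc (r⁻¹ * x₀) (r * x₀) :=
    ⟨mul_le_of_le_one_left hx₀.le (inv_le_one_of_one_le₀ hr.le), le_mul_of_one_le_left hx₀.le hr.le⟩
  have hval₀ := hform x₀ hx₀mem 0
  have hval₁ := hform x₀ hx₀mem 1
  rw [h0eq] at hval₀
  rw [h1eq] at hval₁
  have hgap : |logDensity x₀ (fun u => ρ u + ψ u) x₀ - logDensity x₀ ρ x₀| =
      s * (A * x₀ ^ β * h ^ β) := by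
    have h1 : logBump k 1 x₀ h x₀ = 1 := by simp [logBump, div_self hx₀.ne', hk0]
    rw [hval₀, hval₁, h1, zero_mul, zero_mul, add_zero, one_mul, mul_one, add_sub_cancel_left,
      abs_of_pos (by positivity), ha, Real.rpow_add_one hx₀.ne']
    field_simp
  rw [← hgap]
  exact ofReal_abs_sub_le_minimaxRisk hg hf₀ hf₁ (hm₀ hf₀) (hm₁ hf₁) hn hdom x₀

/-- The inner power is the bandwidth `h` solving the balance equation `n * (A * x₀ ^ (β + 1)) ^ 2 *
h ^ (2 * β + 2 * γ + 1) = 1`, so the rate is the gap between the two hypotheses at `x₀`, up to a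
constant. Taking logarithms reduces this to an identity linear in `log A`, `log x₀` and `log n`. -/
lemma minimaxRate_eq_mul_rpow {A β γ x₀ : ℝ} (hA : 0 < A) (hx₀ : 0 < x₀)
    (hD : 0 < 2 * β + 2 * γ + 1) {n : ℕ} (hn : n ≠ 0) :
    minimaxRate A β γ x₀ n =
      A * x₀ ^ β * ((n * (A * x₀ ^ (β + 1)) ^ 2) ^ (-(2 * β + 2 * γ + 1)⁻¹)) ^ β := by
  have hn0 : (0 : ℝ) < n := by exact_mod_cast Nat.pos_of_ne_zero hn
  unfold minimaxRate
  refine Real.log_injOn_pos (mem_Ioi.2 (by positivity)) (mem_Ioi.2 (by positivity)) ?_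
  rw [Real.log_mul (by positivity) (by positivity), Real.log_rpow hA, Real.log_rpow (by positivity),
    Real.log_mul (by positivity) (by positivity), Real.log_rpow hx₀, Real.log_inv,
    Real.log_mul (by positivity) (by positivity), Real.log_mul (by positivity) (by positivity),
    Real.log_rpow hx₀, Real.log_rpow (by positivity), Real.log_rpow (by positivity),
    Real.log_mul (by positivity) (by positivity), Real.log_pow,
    Real.log_mul (by positivity) (by positivity), Real.log_rpow hx₀]
  generalize hd : 2 * β + 2 * γ + 1 = d at hD ⊢
  obtain rfl : γ = (d - 1 - 2 * β) / 2 := by linarith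
  push_cast
  field_simp
  ring

theorem mainTheorem2 (β r γ ω₀ c₀ B₁ B₂ B : ℝ) (hβ : 0 < β) (hr : 1 < r) (hγ : 1 / 2 < γ) :
    ∃ C₄ : ℝ, 0 < C₄ ∧
      ∀ C₃ : ℝ, 0 < C₃ → ∀ x₀ : ℝ, C₃ ≤ x₀ → ∀ A : ℝ, 0 < A →
      ∀ g : ℝ → ℝ, IsNonnegDensity g → MellinStripAround g 1 →
        MellinPolynomialDecay g 1 γ ω₀ c₀ B₁ B₂ → MellinDerivDecay g 1 γ ω₀ B →
        ENNReal.ofReal C₄ ≤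
          liminf (fun n : ℕ => (ENNReal.ofReal (minimaxRate A β γ x₀ n))⁻¹ *
            minimaxRisk g x₀ n {f | LocalHolderDensity x₀ r A β f}) atTop := by
  have hγ0 : 0 < γ := by linarith
  by_cases hgood : 0 < ω₀ ∧ 0 < B₁ ∧ 0 ≤ B₂ ∧ 0 ≤ B
  swap
  -- For constants of the wrong sign no `g` satisfies the decay conditions, so any `C₄` works. The
  -- sign of `B` is read off from the derivative bound at `ω₀`.
  · refine ⟨1, one_pos, fun _ _ _ _ _ _ g _ _ hdec hder => (hgood ?_).elim⟩
    refine ⟨hdec.ω₀_pos, hdec.B₁_pos, (hdec.B₁_pos.trans hdec.B₁_lt_B₂).le, ?_⟩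
    have h1 := (norm_nonneg _).trans (hder ω₀ (le_abs_self _))
    exact nonneg_of_mul_nonneg_left h1
      (Real.rpow_pos_of_pos (abs_pos.2 hdec.ω₀_pos.ne') _)
  obtain ⟨hω₀, hB₁, hB₂, hB⟩ := hgood
  obtain ⟨s, hs0, hs⟩ := exists_ofReal_le_minimaxRisk (B₁ := B₁) hβ hr hγ0 hω₀ hB₁ hB₂ hB
  refine ⟨s / 3, by positivity, fun C₃ hC₃ x₀ hx₀' A hA g hg hstrip hdec hder => ?_⟩
  have hx₀ : 0 < x₀ := hC₃.trans_le hx₀'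
  obtain ⟨δ, hδ, hbound⟩ := hs x₀ A c₀ g hx₀ hA hg hstrip hdec hder
  have hD : 0 < 2 * β + 2 * γ + 1 := by positivity
  set K := (A * x₀ ^ (β + 1)) ^ 2 with hK
  have hK0 : 0 < K := by positivity
  have hlim : Tendsto (fun n : ℕ => ((n : ℝ) * K) ^ (-(2 * β + 2 * γ + 1)⁻¹)) atTop (nhds 0) :=
    (tendsto_rpow_neg_atTop (inv_pos.2 hD)).comp
      (tendsto_natCast_atTop_atTop.atTop_mul_const hK0)
  refine le_liminf_of_le (by isBoundedDefault) ?_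
  -- The threshold `δ` depends on `g`, `x₀` and `A`, but the balanced bandwidth tends to `0` and
  -- eventually falls below it.
  filter_upwards [hlim.eventually_le_const hδ, eventually_ne_atTop 0] with n hnδ hn
  have hn0 : (0 : ℝ) < n := by exact_mod_cast Nat.pos_of_ne_zero hn
  have hrate := minimaxRate_eq_mul_rpow hA hx₀ hD hn
  have hφ : 0 < minimaxRate A β γ x₀ n := by
    rw [hrate]
    positivity
  have h1 := hbound n _ hn (by positivity) hnδ (by
    rw [← Real.rpow_mul (by positivity), neg_mul, inv_mul_cancel₀ hD.ne', Real.rpow_neg_one,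
      mul_inv_cancel₀ (by positivity)])
  rw [← hrate] at h1
  have hφe : ENNReal.ofReal (minimaxRate A β γ x₀ n) ≠ 0 := by simpa using hφ
  rw [mul_comm, ← div_eq_mul_inv, ENNReal.le_div_iff_mul_le (Or.inl hφe)
    (Or.inl ENNReal.ofReal_ne_top), ← ENNReal.mul_le_mul_iff_right (a := 3) (by norm_num)
    (by norm_num)]
  refine le_trans (le_of_eq ?_) h1
  rw [← ENNReal.ofReal_mul (by positivity), show (3 : ℝ≥0∞) = ENNReal.ofReal 3 by norm_num,
    ← ENNReal.ofReal_mul (by norm_num)]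
  congr 1
  ring
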